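/- Let $\mathcal X,\mathcal Y,\hat{\mathcal X},\hat{\mathcal Y}$ be finite alphabets, $P_{XY}$ a pmf on $\mathcal X\times\mathcal Y$, and $(X^n,Y^n)$ i.i.d. with law $P_{XY}$. Let $d_X:\mathcal X\times\hat{\mathcal X}\to[0,\infty)$ and $d_Y:\mathcal Y\times\hat{\mathcal Y}\to[0,\infty)$ be distortion measures such that every $x$ (every $y$) has some $\hat x$ ($\hat y$) at distortion $0$; the distortion between sequences of length $n$ is the average of the letter distortions. Let $D_1,D_2>0$ and $R_1,R_2\ge 0$. Logarithms are to base 2. An $(n,M_0,M_1,M_2)$-code consists of encoders $f_i:\mathcal X^n\times\mathcal Y^n\to\{1,\dots,M_i\}$, $i=0,1,2$, and decoders $\phi_1:\{1,\dots,M_0\}\times\{1,\dots,M_1\}\to\hat{\mathcal X}^n$, $\phi_2:\{1,\dots,M_0\}\times\{1,\dots,M_2\}\to\hat{\mathcal Y}^n$; put $\hat X^n=\phi_1(f_0,f_1)$, $\hat Y^n=\phi_2(f_0,f_2)$, all $f_i$ evaluated at $(X^n,Y^n)$, and $\epsilon_n=\Pr\big(d_X(X^n,\hat X^n)>D_1\text{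 or }d_Y(Y^n,\hat Y^n)>D_2\big)$. The optimal error exponent $E^*(R_0,R_1,R_2|D_1,D_2)\in[0,\infty]$ is the supremum of all real $E\ge0$ for which there is a sequence of $(n,M_0,M_1,M_2)$-codes with $\limsup_n\frac1n\log M_i\le R_i$ for $i=0,1,2$ and $\liminf_n-\frac1n\log\epsilon_n\ge E$. For a pmf $Q_{XY}$ on $\mathcal X\times\mathcal Y$ let $\mathcal R(D_1,D_2|Q_{XY})$ be the closure of the set of rate triplets $(R_0,R_1,R_2)$ for which there is a sequence of codes with $\limsup_n\frac1n\log M_i\le R_i$ for $i=0,1,2$ and, for the i.i.d. source $Q_{XY}$, $\limsup_n\mathbb E[d_X(X^n,\hat X^n)]\le D_1$ and $\limsup_n\mathbb E[d_Y(Y^n,\hat Y^n)]\le D_2$. Put $\mathsf R_0(R_1,R_2,D_1,D_2|Q_{XY})=\min\{R_0:(R_0,R_1,R_2)\in\mathcal R(D_1,D_2|Q_{XY})\}$ and $$F(P_{XY},R_0,R_1,R_2,D_1,D_2)=\inf_{Q_{XY}:\ \mathsf R_0(R_1,R_2,D_1,D_2|Q_{XY})\ge R_0}D(Q_{XY}\|P_{XY}),\qquad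 \inf\emptyset=\infty.$$ Then for every $R_0\ge0$: $$E^*(R_0,R_1,R_2|D_1,D_2)=F(P_{XY},R_0,R_1,R_2,D_1,D_2)$$ if and only if $r\mapsto F(P_{XY},r,R_1,R_2,D_1,D_2)$ is right-continuous at $R_0$; this is the case for all but at most countably many $R_0\ge0$. Without any continuity assumption, $E^*(R_0,R_1,R_2|D_1,D_2)=\lim_{r\downarrow R_0}F(P_{XY},r,R_1,R_2,D_1,D_2)$ for every $R_0\ge 0$. -/

import Mathlib

open Filter Topology

namespace GrayWyner

noncomputable section

/-- An `(n, M₀, M₁, M₂)`-code: three encoders, each of which sees both source sequences, and two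
decoders; the message of the encoder `f0` is seen by both decoders. -/
structure Code (X Y Xh Yh : Type*) (n M0 M1 M2 : ℕ) where
  f0 : (Fin n → X) → (Fin n → Y) → Fin M0
  f1 : (Fin n → X) → (Fin n → Y) → Fin M1
  f2 : (Fin n → X) → (Fin n → Y) → Fin M2
  φ1 : Fin M0 → Fin M1 → (Fin n → Xh)
  φ2 : Fin M0 → Fin M2 → (Fin n → Yh)

/-- The reproduction of the first source sequence. -/
def Code.xhat {X Y Xh Yh : Type*} {n M0 M1 M2 : ℕ} (c : Code X Y Xh Yh n M0 M1 M2)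
    (x : Fin n → X) (y : Fin n → Y) : Fin n → Xh :=
  c.φ1 (c.f0 x y) (c.f1 x y)

/-- The reproduction of the second source sequence. -/
def Code.yhat {X Y Xh Yh : Type*} {n M0 M1 M2 : ℕ} (c : Code X Y Xh Yh n M0 M1 M2)
    (x : Fin n → X) (y : Fin n → Y) : Fin n → Yh :=
  c.φ2 (c.f0 x y) (c.f2 x y)

/-- The average distortion between two sequences of length `n`. -/
def avgDist {A B : Type*} (d : A → B → ℝ) {n : ℕ} (a : Fin n → A) (b : Fin n → B) : ℝ :=
  (∑ i, d (a i) (b i)) / n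

/-- The probability of the pair of sequences `(x, y)` under the i.i.d. source with joint pmf `P`. -/
def iidProb {X Y : Type*} (P : X × Y → ℝ) {n : ℕ} (x : Fin n → X) (y : Fin n → Y) : ℝ :=
  ∏ i, P (x i, y i)

/-- The expected distortion of the first reproduction under the i.i.d. source `P`. -/
def expDistX {X Y Xh Yh : Type*} [Fintype X] [Fintype Y] (P : X × Y → ℝ) (dX : X → Xh → ℝ)
    {n M0 M1 M2 : ℕ} (c : Code X Y Xh Yh n M0 M1 M2) : ℝ :=
  ∑ x : Fin n → X, ∑ y : Fin n → Y, iidProb P x y * avgDist dX x (c.xhat x y)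

/-- The expected distortion of the second reproduction under the i.i.d. source `P`. -/
def expDistY {X Y Xh Yh : Type*} [Fintype X] [Fintype Y] (P : X × Y → ℝ) (dY : Y → Yh → ℝ)
    {n M0 M1 M2 : ℕ} (c : Code X Y Xh Yh n M0 M1 M2) : ℝ :=
  ∑ x : Fin n → X, ∑ y : Fin n → Y, iidProb P x y * avgDist dY y (c.yhat x y)

/-- The (joint) excess-distortion probability of a code under the i.i.d. source `P`. -/
def excessProb {X Y Xh Yh : Type*} [Fintype X] [Fintype Y] (P : X × Y → ℝ)
    (dX : X → Xh → ℝ) (dY : Y → Yh → ℝ) (D1 D2 : ℝ)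
    {n M0 M1 M2 : ℕ} (c : Code X Y Xh Yh n M0 M1 M2) : ℝ :=
  ∑ x : Fin n → X, ∑ y : Fin n → Y,
    if D1 < avgDist dX x (c.xhat x y) ∨ D2 < avgDist dY y (c.yhat x y)
    then iidProb P x y else 0

/-- `limsup (1/n) log₂ Mₙ ≤ R`, the limit superior being taken in the extended reals. -/
def RateAtMost (M : ℕ → ℕ) (R : ℝ) : Prop :=
  limsup (fun n : ℕ => ((Real.logb 2 (M n) / n : ℝ) : EReal)) atTop ≤ (R : EReal)

/-- The rate triplets achievable under the expected distortion criterion. -/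
def achievableRates {X Y Xh Yh : Type*} [Fintype X] [Fintype Y] (P : X × Y → ℝ)
    (dX : X → Xh → ℝ) (dY : Y → Yh → ℝ) (D1 D2 : ℝ) : Set (ℝ × ℝ × ℝ) :=
  {R | ∃ (M0 M1 M2 : ℕ → ℕ) (c : ∀ n, Code X Y Xh Yh n (M0 n) (M1 n) (M2 n)),
    RateAtMost M0 R.1 ∧ RateAtMost M1 R.2.1 ∧ RateAtMost M2 R.2.2 ∧
    limsup (fun n => ((expDistX P dX (c n) : ℝ) : EReal)) atTop ≤ (D1 : EReal) ∧
    limsup (fun n => ((expDistY P dY (c n) : ℝ) : EReal)) atTop ≤ (D2 : EReal)}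

/-- The first-order rate region `𝓡(D₁, D₂ | P)`. -/
def rateRegion {X Y Xh Yh : Type*} [Fintype X] [Fintype Y] (P : X × Y → ℝ)
    (dX : X → Xh → ℝ) (dY : Y → Yh → ℝ) (D1 D2 : ℝ) : Set (ℝ × ℝ × ℝ) :=
  closure (achievableRates P dX dY D1 D2)

/-- The minimum common rate `R₀(R₁, R₂, D₁, D₂ | P)`, which is `⊤` if `(R₀, R₁, R₂)` lies in the
rate region for no `R₀`. -/
def minCommonRate {X Y Xh Yh : Type*} [Fintype X] [Fintype Y] (P : X × Y → ℝ)
    (dX : X → Xh → ℝ) (dY : Y → Yh → ℝ) (R1 R2 D1 D2 : ℝ) : EReal :=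
  ⨅ r ∈ {r : ℝ | (r, R1, R2) ∈ rateRegion P dX dY D1 D2}, (r : EReal)

/-- The relative entropy `D(Q‖P)`, in bits, of two pmfs on a finite set. -/
def relEntropy {A : Type*} [Fintype A] (Q P : A → ℝ) : EReal :=
  if ∀ a, P a = 0 → Q a = 0 then ((∑ a, Q a * Real.logb 2 (Q a / P a) : ℝ) : EReal) else ⊤

/-- The function `F(P, R₀, R₁, R₂, D₁, D₂)`; the infimum over the empty set is `⊤`. -/
def expFun {X Y Xh Yh : Type*} [Fintype X] [Fintype Y] (P : X × Y → ℝ)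
    (dX : X → Xh → ℝ) (dY : Y → Yh → ℝ) (R0 R1 R2 D1 D2 : ℝ) : EReal :=
  ⨅ Q ∈ {Q : X × Y → ℝ | Q ∈ stdSimplex ℝ (X × Y) ∧
    (R0 : EReal) ≤ minCommonRate Q dX dY R1 R2 D1 D2}, relEntropy Q P

/-- `-(1/n) log₂ ε`, which is `⊤` for `ε = 0`. -/
def errExponent (n : ℕ) (ε : ℝ) : EReal :=
  if ε = 0 then ⊤ else ((-Real.logb 2 ε / n : ℝ) : EReal)

/-- `E` is an achievable error exponent. -/
def AchievableExponent {X Y Xh Yh : Type*} [Fintype X] [Fintype Y] (P : X × Y → ℝ)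
    (dX : X → Xh → ℝ) (dY : Y → Yh → ℝ) (R0 R1 R2 D1 D2 E : ℝ) : Prop :=
  0 ≤ E ∧ ∃ (M0 M1 M2 : ℕ → ℕ) (c : ∀ n, Code X Y Xh Yh n (M0 n) (M1 n) (M2 n)),
    RateAtMost M0 R0 ∧ RateAtMost M1 R1 ∧ RateAtMost M2 R2 ∧
    (E : EReal) ≤ liminf (fun n => errExponent n (excessProb P dX dY D1 D2 (c n))) atTop

/-- The optimal error exponent (reliability function) `E*(R₀, R₁, R₂ | D₁, D₂)`. -/
def optExponent {X Y Xh Yh : Type*} [Fintype X] [Fintype Y] (P : X × Y → ℝ)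
    (dX : X → Xh → ℝ) (dY : Y → Yh → ℝ) (R0 R1 R2 D1 D2 : ℝ) : EReal :=
  ⨆ E ∈ {E : ℝ | AchievableExponent P dX dY R0 R1 R2 D1 D2 E}, (E : EReal)

end

end GrayWyner

namespace GrayWyner

/-- There is a code on the index set `ι`, with message sets `A0`, `A1`, `A2`, whose total
distortions are at most `Δ1` and `Δ2` on every source sequence in `S`. -/
def Covers {X Y Xh Yh ι : Type*} [Fintype ι] (dX : X → Xh → ℝ) (dY : Y → Yh → ℝ)
    (A0 A1 A2 : Type*) (Δ1 Δ2 : ℝ) (S : Set (ι → X × Y)) : Prop :=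
  ∃ (f0 : (ι → X × Y) → A0) (f1 : (ι → X × Y) → A1) (f2 : (ι → X × Y) → A2)
    (φ1 : A0 → A1 → ι → Xh) (φ2 : A0 → A2 → ι → Yh), ∀ z ∈ S,
      ∑ i, dX (z i).1 (φ1 (f0 z) (f1 z) i) ≤ Δ1 ∧ ∑ i, dY (z i).2 (φ2 (f0 z) (f2 z) i) ≤ Δ2

section Covers

variable {X Y Xh Yh ι : Type*} [Fintype ι] {dX : X → Xh → ℝ} {dY : Y → Yh → ℝ}

theorem Covers.mono {A0 A1 A2 : Type*} {Δ1 Δ2 Δ1' Δ2' : ℝ} {S S' : Set (ι → X × Y)}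
    (h : Covers dX dY A0 A1 A2 Δ1 Δ2 S) (hS : S' ⊆ S) (h1 : Δ1 ≤ Δ1') (h2 : Δ2 ≤ Δ2') :
    Covers dX dY A0 A1 A2 Δ1' Δ2' S' := by
  obtain ⟨f0, f1, f2, φ1, φ2, h⟩ := h
  exact ⟨f0, f1, f2, φ1, φ2, fun z hz => ⟨(h z (hS hz)).1.trans h1, (h z (hS hz)).2.trans h2⟩⟩

theorem Covers.reindex {ι' A0 A1 A2 : Type*} [Fintype ι'] {Δ1 Δ2 : ℝ} {S : Set (ι → X × Y)}
    (h : Covers dX dY A0 A1 A2 Δ1 Δ2 S) (e : ι ≃ ι') :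
    Covers dX dY A0 A1 A2 Δ1 Δ2 {z : ι' → X × Y | z ∘ e ∈ S} := by
  obtain ⟨f0, f1, f2, φ1, φ2, h⟩ := h
  refine ⟨fun z => f0 (z ∘ e), fun z => f1 (z ∘ e), fun z => f2 (z ∘ e),
    fun a b i => φ1 a b (e.symm i), fun a b i => φ2 a b (e.symm i), fun z hz => ?_⟩
  obtain ⟨h1, h2⟩ := h _ hz
  rw [← e.sum_comp, ← e.sum_comp (fun i => dY _ _)]
  simpa using And.intro h1 h2

theorem Covers.iUnion {T A0 A1 A2 : Type*} [Nonempty T] {Δ1 Δ2 : ℝ} {S : T → Set (ι → X × Y)}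
    (h : ∀ t, Covers dX dY A0 A1 A2 Δ1 Δ2 (S t)) :
    Covers dX dY (T × A0) A1 A2 Δ1 Δ2 (⋃ t, S t) := by
  classical
  choose f0 f1 f2 φ1 φ2 h using h
  let s : (ι → X × Y) → T := fun z =>
    if hz : ∃ t, z ∈ S t then hz.choose else Classical.arbitrary T
  refine ⟨fun z => (s z, f0 (s z) z), fun z => f1 (s z) z, fun z => f2 (s z) z,
    fun a b => φ1 a.1 a.2 b, fun a b => φ2 a.1 a.2 b, fun z hz => ?_⟩
  have hz' : ∃ t, z ∈ S t := by simpa using hz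
  have hs : z ∈ S (s z) := by
    simp only [s, dif_pos hz']
    exact hz'.choose_spec
  exact h _ z hs

theorem Covers.of_card_le {A0 A1 A2 : Type*} [Fintype A0] [Fintype A1] [Fintype A2]
    [Nonempty A0] [Nonempty A1] [Nonempty A2] {M0 M1 M2 : ℕ}
    {Δ1 Δ2 : ℝ} {S : Set (ι → X × Y)} (h : Covers dX dY A0 A1 A2 Δ1 Δ2 S)
    (h0 : Fintype.card A0 ≤ M0) (h1 : Fintype.card A1 ≤ M1) (h2 : Fintype.card A2 ≤ M2) :
    Covers dX dY (Fin M0) (Fin M1) (Fin M2) Δ1 Δ2 S := by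
  obtain ⟨e0⟩ : Nonempty (A0 ↪ Fin M0) :=
    Function.Embedding.nonempty_of_card_le (by simpa using h0)
  obtain ⟨e1⟩ : Nonempty (A1 ↪ Fin M1) :=
    Function.Embedding.nonempty_of_card_le (by simpa using h1)
  obtain ⟨e2⟩ : Nonempty (A2 ↪ Fin M2) :=
    Function.Embedding.nonempty_of_card_le (by simpa using h2)
  obtain ⟨f0, f1, f2, φ1, φ2, h⟩ := h
  refine ⟨fun z => e0 (f0 z), fun z => e1 (f1 z), fun z => e2 (f2 z),
    fun a b => φ1 (Function.invFun e0 a) (Function.invFun e1 b),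
    fun a b => φ2 (Function.invFun e0 a) (Function.invFun e2 b), fun z hz => ?_⟩
  simp only [Function.leftInverse_invFun e0.injective _, Function.leftInverse_invFun e1.injective _,
    Function.leftInverse_invFun e2.injective _]
  exact h z hz

/-- A set of sequences is decoded perfectly, letter by letter, on `C`, and with a code that covers
`G` on each of the blocks `{j} × κ`, at most `b` of which lie outside `G`. -/
theorem Covers.blocks {J κ C A0 A1 A2 : Type*} [Fintype J] [Fintype κ] [Fintype C]
    {Δ1 Δ2 B : ℝ} {G : Set (κ → X × Y)} [DecidablePred (· ∈ G)] (b : ℝ)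
    (hdX0 : ∀ x, ∃ xh, dX x xh = 0) (hdY0 : ∀ y, ∃ yh, dY y yh = 0)
    (hB : 0 ≤ B) (hBX : ∀ x xh, dX x xh ≤ B) (hBY : ∀ y yh, dY y yh ≤ B)
    (hΔ1 : 0 ≤ Δ1) (hΔ2 : 0 ≤ Δ2)
    (h : Covers dX dY A0 A1 A2 Δ1 Δ2 G) :
    Covers dX dY ((J → A0) × (C → Xh) × (C → Yh)) (J → A1) (J → A2)
      (Fintype.card J * Δ1 + b * (Fintype.card κ * B))
      (Fintype.card J * Δ2 + b * (Fintype.card κ * B))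
      {z : (J × κ) ⊕ C → X × Y |
        ((Finset.univ.filter fun j => (fun i => z (.inl (j, i))) ∉ G).card : ℝ) ≤ b} := by
  choose ox hox using hdX0
  choose oy hoy using hdY0
  obtain ⟨f0, f1, f2, φ1, φ2, h⟩ := h
  refine ⟨fun z => (fun j => f0 fun i => z (.inl (j, i)), fun i => ox (z (.inr i)).1,
      fun i => oy (z (.inr i)).2), fun z j => f1 fun i => z (.inl (j, i)),
    fun z j => f2 fun i => z (.inl (j, i)),
    fun a c => Sum.elim (fun p => φ1 (a.1 p.1) (c p.1) p.2) a.2.1,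
    fun a c => Sum.elim (fun p => φ2 (a.1 p.1) (c p.1) p.2) a.2.2, fun z hz => ?_⟩
  have key : ∀ (Δ : ℝ) (D : J → κ → ℝ), 0 ≤ Δ → (∀ j i, D j i ≤ B) →
      (∀ j, (fun i => z (.inl (j, i))) ∈ G → ∑ i, D j i ≤ Δ) →
      ∑ j, ∑ i, D j i ≤ Fintype.card J * Δ + b * (Fintype.card κ * B) := by
    intro Δ D hΔ hD hG
    calc ∑ j, ∑ i, D j i
        ≤ ∑ j, (Δ + if (fun i => z (.inl (j, i))) ∉ G then (Fintype.card κ * B) else 0) := by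
          refine Finset.sum_le_sum fun j _ => ?_
          split_ifs with hj
          · simpa using hG j hj
          · have : ∑ i, D j i ≤ ∑ _i : κ, B := Finset.sum_le_sum fun i _ => hD j i
            simp at this
            linarith
      _ = Fintype.card J * Δ +
          (Finset.univ.filter fun j => (fun i => z (.inl (j, i))) ∉ G).card *
            (Fintype.card κ * B) := by
          rw [Finset.sum_add_distrib, ← Finset.sum_filter]
          simp
      _ ≤ _ := by
          have : 0 ≤ (Fintype.card κ * B) := by positivity
          have := mul_le_mul_of_nonneg_right hz this
          linarith
  constructor
  · rw [Fintype.sum_sum_type, Fintype.sum_prod_type]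
    simp only [Sum.elim_inl, Sum.elim_inr, hox, Finset.sum_const_zero, add_zero]
    exact key Δ1 _ hΔ1 (fun _ _ => hBX _ _) fun j hj => (h _ hj).1
  · rw [Fintype.sum_sum_type, Fintype.sum_prod_type]
    simp only [Sum.elim_inl, Sum.elim_inr, hoy, Finset.sum_const_zero, add_zero]
    exact key Δ2 _ hΔ2 (fun _ _ => hBY _ _) fun j hj => (h _ hj).2

end Covers

open scoped Nat in
theorem card_perm_comp_eq_le {κ ι : Type*} [Fintype κ] [Fintype ι] [DecidableEq ι]
    [DecidableEq κ] {b : κ → ι} (hb : Function.Injective b) (f : κ → ι) :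
    (Finset.univ.filter fun π : Equiv.Perm ι => π ∘ b = f).card
      ≤ (Fintype.card ι - Fintype.card κ)! := by
  by_cases hf : Function.Injective f
  · rw [← Fintype.card_subtype]
    have hc : ∀ g : κ → ι, Function.Injective g →
        Fintype.card ((Set.range g)ᶜ : Set ι) = Fintype.card ι - Fintype.card κ := by
      intro g hg
      rw [Fintype.card_compl_set, Set.card_range_of_injective hg]
    have := Fintype.card_embedding_eq (α := ((Set.range b)ᶜ : Set ι))
      (β := ((Set.range f)ᶜ : Set ι))
    rw [hc b hb, hc f hf, Nat.descFactorial_self] at this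
    rw [← this]
    refine Fintype.card_le_of_injective (fun π => ⟨fun i => ⟨π.1 i.1, ?_⟩, ?_⟩) ?_
    · rintro ⟨l, hl⟩
      exact i.2 ⟨l, π.1.injective ((congrFun π.2 l).trans hl)⟩
    · intro i i' h
      exact Subtype.ext (π.1.injective (Subtype.ext_iff.mp h))
    · intro π π' h
      refine Subtype.ext (Equiv.ext fun i => ?_)
      by_cases hi : i ∈ Set.range b
      · obtain ⟨l, rfl⟩ := hi
        exact (congrFun π.2 l).trans (congrFun π'.2 l).symm
      · exact Subtype.ext_iff.mp (DFunLike.congr_fun h ⟨i, hi⟩)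
  · rw [Finset.card_eq_zero.mpr]
    · exact Nat.zero_le _
    · refine Finset.filter_eq_empty_iff.mpr fun π _ h => hf ?_
      rw [← h]
      exact π.injective.comp hb

/-- The empirical distribution of a finite family. -/
noncomputable def empirical {ι A : Type*} [Fintype ι] [DecidableEq A] (z : ι → A) (a : A) : ℝ :=
  (Finset.univ.filter fun i => z i = a).card / Fintype.card ι

theorem empirical_comp_equiv {ι ι' A : Type*} [Fintype ι] [Fintype ι'] [DecidableEq A]
    (e : ι ≃ ι') (z : ι' → A) : empirical (z ∘ e) = empirical z := by
  funext a
  unfold empirical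
  rw [Fintype.card_congr e]
  congr 2
  refine Finset.card_bij (fun i _ => e i) (by simp) (by simp) fun i hi => ⟨e.symm i, by simpa using hi⟩

theorem empirical_mem_stdSimplex {ι A : Type*} [Fintype ι] [Nonempty ι] [Fintype A]
    [DecidableEq A] (z : ι → A) : empirical z ∈ stdSimplex ℝ A := by
  refine ⟨fun a => by unfold empirical; positivity, ?_⟩
  unfold empirical
  rw [← Finset.sum_div, div_eq_one_iff_eq (by simp)]
  have := Finset.card_eq_sum_card_fiberwise (f := z) (s := Finset.univ) (t := Finset.univ)
    (by simp)
  rw [← Finset.card_univ, this]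
  push_cast
  rfl

theorem card_comp_mem {κ ι A : Type*} [Fintype κ] [Fintype ι] [Fintype A] [DecidableEq A]
    [DecidableEq κ] [Nonempty ι] (z : ι → A) (G : Set (κ → A)) [DecidablePred (· ∈ G)] :
    ((Finset.univ.filter fun f : κ → ι => z ∘ f ∉ G).card : ℝ)
      = (Fintype.card ι : ℝ) ^ Fintype.card κ *
        ∑ w : κ → A, if w ∉ G then ∏ i, empirical z (w i) else 0 := by
  classical
  rw [Finset.card_eq_sum_card_fiberwise (f := fun f : κ → ι => z ∘ f)
    (t := Finset.univ.filter fun w => w ∉ G) (fun f hf => by simpa using hf)]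
  rw [← Finset.sum_filter, Finset.mul_sum]
  push_cast
  refine Finset.sum_congr rfl fun w hw => ?_
  have : ((Finset.univ.filter fun f : κ → ι => z ∘ f ∉ G).filter fun f => z ∘ f = w)
      = Fintype.piFinset fun l => Finset.univ.filter fun i => z i = w l := by
    ext f
    simp only [Finset.mem_filter, Finset.mem_univ, true_and, Fintype.mem_piFinset] at hw ⊢
    constructor
    · rintro ⟨-, rfl⟩ l
      rfl
    · intro h
      have : z ∘ f = w := funext h
      exact ⟨this ▸ hw, this⟩
  rw [this, Fintype.card_piFinset]
  unfold empirical
  rw [Finset.prod_div_distrib, Finset.prod_const, Finset.card_univ]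
  push_cast
  field_simp

open scoped Nat in
theorem card_perm_block_le {κ ι A : Type*} [Fintype κ] [Fintype ι] [Fintype A] [DecidableEq A]
    [DecidableEq κ] [DecidableEq ι] [Nonempty ι] {b : κ → ι} (hb : Function.Injective b)
    (z : ι → A) (G : Set (κ → A)) [DecidablePred (· ∈ G)] :
    ((Finset.univ.filter fun π : Equiv.Perm ι => z ∘ π ∘ b ∉ G).card : ℝ)
      ≤ (Fintype.card ι - Fintype.card κ)! * (Fintype.card ι : ℝ) ^ Fintype.card κ *
        ∑ w : κ → A, if w ∉ G then ∏ i, empirical z (w i) else 0 := by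
  rw [mul_assoc, ← card_comp_mem]
  rw [Finset.card_eq_sum_card_fiberwise (f := fun π : Equiv.Perm ι => π ∘ b)
    (t := Finset.univ.filter fun f => z ∘ f ∉ G) (fun f hf => by simpa using hf)]
  norm_cast
  rw [mul_comm, ← smul_eq_mul, ← Finset.sum_const]
  refine Finset.sum_le_sum fun f _ => le_trans (Finset.card_le_card ?_) (card_perm_comp_eq_le hb f)
  intro π hπ
  simp only [Finset.mem_filter] at hπ ⊢
  exact ⟨Finset.mem_univ _, hπ.2⟩

/-- Each point of a finite set `S` being hit by at least half of the elements of `Ω`, some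
`N` elements of `Ω` hit all of `S` as soon as `S` has less than `2 ^ N` points. -/
theorem exists_hitting_family {Ω Z : Type*} [Fintype Ω] [Nonempty Ω] (good : Ω → Z → Prop)
    [∀ ω, DecidablePred (good ω)] [∀ z, DecidablePred fun ω => good ω z] (N : ℕ) (S : Finset Z)
    (hS : ∀ z ∈ S, 2 * (Finset.univ.filter fun ω => ¬ good ω z).card ≤ Fintype.card Ω)
    (hN : S.card < 2 ^ N) : ∃ p : Fin N → Ω, ∀ z ∈ S, ∃ t, good (p t) z := by
  induction N generalizing S with
  | zero =>
    have : S = ∅ := by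
      rw [← Finset.card_eq_zero]
      simpa using hN
    exact ⟨Fin.elim0, by simp [this]⟩
  | succ N ih =>
    obtain ⟨ω, hω⟩ : ∃ ω, 2 * (S.filter fun z => ¬ good ω z).card ≤ S.card := by
      by_contra! hcon
      have h1 : ∑ ω : Ω, 2 * (S.filter fun z => ¬ good ω z).card
          = ∑ z ∈ S, 2 * (Finset.univ.filter fun ω => ¬ good ω z).card := by
        simp only [Finset.card_filter, ← Finset.mul_sum]
        rw [Finset.sum_comm]
      have h2 := Finset.sum_lt_sum_of_nonempty (s := (Finset.univ : Finset Ω))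
        Finset.univ_nonempty fun ω _ => hcon ω
      have h3 := Finset.sum_le_sum hS
      rw [h1] at h2
      simp only [Finset.sum_const, smul_eq_mul, Finset.card_univ] at h2 h3
      rw [mul_comm] at h2
      omega
    obtain ⟨p, hp⟩ := ih (S.filter fun z => ¬ good ω z)
      (fun z hz => hS z (Finset.mem_of_mem_filter z hz)) (by rw [pow_succ] at hN; omega)
    refine ⟨Fin.cons ω p, fun z hz => ?_⟩
    by_cases hg : good ω z
    · exact ⟨0, by simpa using hg⟩
    · obtain ⟨t, ht⟩ := hp z (Finset.mem_filter.mpr ⟨hz, hg⟩)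
      exact ⟨t.succ, by simpa using ht⟩

/-- The product of a mass function over a finite index set. -/
noncomputable def prodProb {ι A : Type*} [Fintype ι] (Q : A → ℝ) (z : ι → A) : ℝ := ∏ i, Q (z i)

theorem prodProb_nonneg {ι A : Type*} [Fintype ι] {Q : A → ℝ} (hQ : ∀ a, 0 ≤ Q a) (z : ι → A) :
    0 ≤ prodProb Q z := Finset.prod_nonneg fun _ _ => hQ _

theorem sum_prodProb {ι A : Type*} [Fintype ι] [DecidableEq ι] [Fintype A] {Q : A → ℝ}
    (hQ : Q ∈ stdSimplex ℝ A) : ∑ z : ι → A, prodProb Q z = 1 := by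
  have := Finset.prod_univ_sum (ι := ι) (fun _ => (Finset.univ : Finset A)) fun _ a => Q a
  rw [Fintype.piFinset_univ] at this
  unfold prodProb
  rw [← this]
  simp [hQ.2]

theorem prodProb_mem_stdSimplex {ι A : Type*} [Fintype ι] [DecidableEq ι] [Fintype A] {Q : A → ℝ}
    (hQ : Q ∈ stdSimplex ℝ A) : (fun z : ι → A => prodProb Q z) ∈ stdSimplex ℝ (ι → A) :=
  ⟨prodProb_nonneg hQ.1, sum_prodProb hQ⟩

theorem sum_fin_succ_fun {A : Type*} [Fintype A] (n : ℕ) (F : (Fin (n + 1) → A) → ℝ) :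
    ∑ z, F z = ∑ a : A, ∑ w : Fin n → A, F (Fin.cons a w) := by
  rw [← (Fin.consEquiv fun _ : Fin (n + 1) => A).sum_comp, Fintype.sum_prod_type]
  rfl

theorem sum_prodProb_mul_sum {A : Type*} [Fintype A] {Q : A → ℝ} (hQ : Q ∈ stdSimplex ℝ A)
    {g : A → ℝ} (hg : ∑ a, Q a * g a = 0) (n : ℕ) :
    ∑ z : Fin n → A, prodProb Q z * ∑ i, g (z i) = 0 := by
  induction n with
  | zero => simp
  | succ n ih =>
    rw [sum_fin_succ_fun]
    have : ∀ a, ∑ w : Fin n → A, prodProb Q (Fin.cons a w : Fin (n + 1) → A) *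
        ∑ i, g ((Fin.cons a w : Fin (n + 1) → A) i) = Q a * g a := by
      intro a
      simp only [prodProb, Fin.prod_univ_succ, Fin.sum_univ_succ, Fin.cons_zero, Fin.cons_succ]
      change ∑ w : Fin n → A, Q a * prodProb Q w * (g a + ∑ i, g (w i)) = _
      simp only [mul_add, Finset.sum_add_distrib, mul_assoc (Q a), ← Finset.mul_sum, ih]
      rw [← Finset.sum_mul, sum_prodProb hQ]
      ring
    simp only [this, hg]

theorem sum_prodProb_mul_sum_sq {A : Type*} [Fintype A] {Q : A → ℝ} (hQ : Q ∈ stdSimplex ℝ A)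
    {g : A → ℝ} (hg : ∑ a, Q a * g a = 0) (n : ℕ) :
    ∑ z : Fin n → A, prodProb Q z * (∑ i, g (z i)) ^ 2 = n * ∑ a, Q a * g a ^ 2 := by
  induction n with
  | zero => simp
  | succ n ih =>
    rw [sum_fin_succ_fun]
    have : ∀ a, ∑ w : Fin n → A, prodProb Q (Fin.cons a w : Fin (n + 1) → A) *
        (∑ i, g ((Fin.cons a w : Fin (n + 1) → A) i)) ^ 2
          = Q a * g a ^ 2 + Q a * (n * ∑ a, Q a * g a ^ 2) := by
      intro a
      simp only [prodProb, Fin.prod_univ_succ, Fin.sum_univ_succ, Fin.cons_zero, Fin.cons_succ]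
      change ∑ w : Fin n → A, Q a * prodProb Q w * (g a + ∑ i, g (w i)) ^ 2 = _
      have h : ∀ w : Fin n → A, Q a * prodProb Q w * (g a + ∑ i, g (w i)) ^ 2
          = Q a * g a ^ 2 * prodProb Q w + 2 * Q a * g a * (prodProb Q w * ∑ i, g (w i))
            + Q a * (prodProb Q w * (∑ i, g (w i)) ^ 2) := fun w => by ring
      simp only [h, Finset.sum_add_distrib, ← Finset.mul_sum, ih, sum_prodProb hQ,
        sum_prodProb_mul_sum hQ hg]
      ring
    simp only [this, Finset.sum_add_distrib, ← Finset.sum_mul, hQ.2]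
    push_cast
    ring

/-- Chebyshev's inequality for sums of independent, identically distributed variables. -/
theorem sum_prodProb_lt_le {A : Type*} [Fintype A] {Q : A → ℝ} (hQ : Q ∈ stdSimplex ℝ A)
    (f : A → ℝ) {c : ℝ} (hc : ∑ a, Q a * f a < c) :
    ∃ V : ℝ, ∀ n : ℕ, 0 < n →
      ∑ z : Fin n → A, (if n * c < ∑ i, f (z i) then prodProb Q z else 0) ≤ V / n := by
  set μ := ∑ a, Q a * f a with hμ
  set g : A → ℝ := fun a => f a - μ with hgdef
  have hg : ∑ a, Q a * g a = 0 := by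
    simp only [hgdef, mul_sub, Finset.sum_sub_distrib, ← Finset.sum_mul, hQ.2]
    rw [← hμ]
    ring
  refine ⟨(∑ a, Q a * g a ^ 2) / (c - μ) ^ 2, fun n hn => ?_⟩
  have hc' : 0 < c - μ := by linarith
  have hn' : (0 : ℝ) < n := by exact_mod_cast hn
  have hpos : 0 < (n * (c - μ)) ^ 2 := by positivity
  have h : (n * (c - μ)) ^ 2 *
      ∑ z : Fin n → A, (if n * c < ∑ i, f (z i) then prodProb Q z else 0)
        ≤ n * ∑ a, Q a * g a ^ 2 := by
    rw [← sum_prodProb_mul_sum_sq hQ hg n, Finset.mul_sum]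
    refine Finset.sum_le_sum fun z _ => ?_
    have hz := prodProb_nonneg hQ.1 z
    split_ifs with hlt
    · rw [mul_comm]
      refine mul_le_mul_of_nonneg_left ?_ hz
      refine pow_le_pow_left₀ (by positivity) ?_ 2
      simp only [hgdef, Finset.sum_sub_distrib, Finset.sum_const, Finset.card_univ,
        Fintype.card_fin, nsmul_eq_mul]
      linarith
    · rw [mul_zero]
      positivity
  rw [mul_comm, ← le_div_iff₀ hpos] at h
  refine h.trans (le_of_eq ?_)
  field_simp

theorem sum_sum_eq_sum_prod {X Y ι : Type*} [Fintype X] [Fintype Y] [Fintype ι] [DecidableEq ι]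
    (F : (ι → X) → (ι → Y) → ℝ) :
    ∑ x, ∑ y, F x y = ∑ z : ι → X × Y, F (fun i => (z i).1) fun i => (z i).2 := by
  rw [← Fintype.sum_prod_type', ← (Equiv.arrowProdEquivProdArrow ι (fun _ => X) fun _ => Y).sum_comp]
  rfl

theorem expDistX_eq {X Y Xh Yh : Type*} [Fintype X] [Fintype Y] (P : X × Y → ℝ)
    (dX : X → Xh → ℝ) {n M0 M1 M2 : ℕ} (c : Code X Y Xh Yh n M0 M1 M2) :
    expDistX P dX c = ∑ z : Fin n → X × Y, prodProb P z *
      avgDist dX (fun i => (z i).1) (c.xhat (fun i => (z i).1) fun i => (z i).2) :=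
  sum_sum_eq_sum_prod _

theorem expDistY_eq {X Y Xh Yh : Type*} [Fintype X] [Fintype Y] (P : X × Y → ℝ)
    (dY : Y → Yh → ℝ) {n M0 M1 M2 : ℕ} (c : Code X Y Xh Yh n M0 M1 M2) :
    expDistY P dY c = ∑ z : Fin n → X × Y, prodProb P z *
      avgDist dY (fun i => (z i).2) (c.yhat (fun i => (z i).1) fun i => (z i).2) :=
  sum_sum_eq_sum_prod _

theorem excessProb_eq {X Y Xh Yh : Type*} [Fintype X] [Fintype Y] (P : X × Y → ℝ)
    (dX : X → Xh → ℝ) (dY : Y → Yh → ℝ) (D1 D2 : ℝ) {n M0 M1 M2 : ℕ}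
    (c : Code X Y Xh Yh n M0 M1 M2) :
    excessProb P dX dY D1 D2 c = ∑ z : Fin n → X × Y,
      if D1 < avgDist dX (fun i => (z i).1) (c.xhat (fun i => (z i).1) fun i => (z i).2) ∨
        D2 < avgDist dY (fun i => (z i).2) (c.yhat (fun i => (z i).1) fun i => (z i).2)
      then prodProb P z else 0 :=
  sum_sum_eq_sum_prod _

theorem excessProb_nonneg {X Y Xh Yh : Type*} [Fintype X] [Fintype Y] {P : X × Y → ℝ}
    (hP : ∀ a, 0 ≤ P a) (dX : X → Xh → ℝ) (dY : Y → Yh → ℝ) (D1 D2 : ℝ) {n M0 M1 M2 : ℕ}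
    (c : Code X Y Xh Yh n M0 M1 M2) : 0 ≤ excessProb P dX dY D1 D2 c := by
  rw [excessProb_eq]
  refine Finset.sum_nonneg fun z _ => ?_
  split_ifs
  exacts [prodProb_nonneg hP z, le_rfl]

theorem excessProb_le_one {X Y Xh Yh : Type*} [Fintype X] [Fintype Y] {P : X × Y → ℝ}
    (hP : P ∈ stdSimplex ℝ (X × Y)) (dX : X → Xh → ℝ) (dY : Y → Yh → ℝ) (D1 D2 : ℝ)
    {n M0 M1 M2 : ℕ} (c : Code X Y Xh Yh n M0 M1 M2) : excessProb P dX dY D1 D2 c ≤ 1 := by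
  rw [excessProb_eq, ← sum_prodProb (ι := Fin n) hP]
  refine Finset.sum_le_sum fun z _ => ?_
  split_ifs
  exacts [le_rfl, prodProb_nonneg hP.1 z]

theorem avgDist_le {A B : Type*} {d : A → B → ℝ} {K : ℝ} (hK : 0 ≤ K) (hd : ∀ a b, d a b ≤ K)
    {n : ℕ} (a : Fin n → A) (b : Fin n → B) : avgDist d a b ≤ K := by
  unfold avgDist
  refine div_le_of_le_mul₀ (Nat.cast_nonneg _) hK ?_
  have : ∑ i, d (a i) (b i) ≤ ∑ _i : Fin n, K := Finset.sum_le_sum fun i _ => hd _ _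
  simpa [mul_comm] using this

theorem expDistX_le {X Y Xh Yh : Type*} [Fintype X] [Fintype Y] {Q : X × Y → ℝ}
    (hQ : Q ∈ stdSimplex ℝ (X × Y)) (dX : X → Xh → ℝ) (dY : Y → Yh → ℝ) {D1 K : ℝ} (D2 : ℝ)
    (hD1 : 0 ≤ D1) (hK : 0 ≤ K) (hd : ∀ a b, dX a b ≤ K) {n M0 M1 M2 : ℕ}
    (c : Code X Y Xh Yh n M0 M1 M2) :
    expDistX Q dX c ≤ D1 + K * excessProb Q dX dY D1 D2 c := by
  have h1 : D1 = ∑ z : Fin n → X × Y, prodProb Q z * D1 := by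
    rw [← Finset.sum_mul, sum_prodProb hQ, one_mul]
  rw [expDistX_eq, excessProb_eq, Finset.mul_sum]
  conv_rhs => enter [1]; rw [h1]
  rw [← Finset.sum_add_distrib]
  refine Finset.sum_le_sum fun z _ => ?_
  have hz := prodProb_nonneg hQ.1 z
  split_ifs with h
  · have := mul_le_mul_of_nonneg_left (avgDist_le hK hd (fun i => (z i).1)
      (c.xhat (fun i => (z i).1) fun i => (z i).2)) hz
    nlinarith
  · push Not at h
    simpa using mul_le_mul_of_nonneg_left h.1 hz

theorem expDistY_le {X Y Xh Yh : Type*} [Fintype X] [Fintype Y] {Q : X × Y → ℝ}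
    (hQ : Q ∈ stdSimplex ℝ (X × Y)) (dX : X → Xh → ℝ) (dY : Y → Yh → ℝ) {D2 K : ℝ} (D1 : ℝ)
    (hD2 : 0 ≤ D2) (hK : 0 ≤ K) (hd : ∀ a b, dY a b ≤ K) {n M0 M1 M2 : ℕ}
    (c : Code X Y Xh Yh n M0 M1 M2) :
    expDistY Q dY c ≤ D2 + K * excessProb Q dX dY D1 D2 c := by
  have h1 : D2 = ∑ z : Fin n → X × Y, prodProb Q z * D2 := by
    rw [← Finset.sum_mul, sum_prodProb hQ, one_mul]
  rw [expDistY_eq, excessProb_eq, Finset.mul_sum]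
  conv_rhs => enter [1]; rw [h1]
  rw [← Finset.sum_add_distrib]
  refine Finset.sum_le_sum fun z _ => ?_
  have hz := prodProb_nonneg hQ.1 z
  split_ifs with h
  · have := mul_le_mul_of_nonneg_left (avgDist_le hK hd (fun i => (z i).2)
      (c.yhat (fun i => (z i).1) fun i => (z i).2)) hz
    nlinarith
  · push Not at h
    simpa using mul_le_mul_of_nonneg_left h.2 hz

/-- The likelihood ratio of two product distributions is two to the sum of the letterwise
logarithmic likelihood ratios. -/
theorem prodProb_eq_two_rpow_mul {ι A : Type*} [Fintype ι] {Q P : A → ℝ} (hQ : ∀ a, 0 ≤ Q a)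
    (hP : ∀ a, 0 ≤ P a) (z : ι → A) (hz : ∀ i, Q (z i) ≠ 0) (hz' : ∀ i, P (z i) ≠ 0) :
    prodProb Q z = (2 : ℝ) ^ (∑ i, Real.logb 2 (Q (z i) / P (z i))) * prodProb P z := by
  rw [Real.rpow_sum_of_pos two_pos]
  unfold prodProb
  rw [← Finset.prod_mul_distrib]
  refine Finset.prod_congr rfl fun i _ => ?_
  have h1 : 0 < Q (z i) := lt_of_le_of_ne (hQ _) (hz i).symm
  have h2 : 0 < P (z i) := lt_of_le_of_ne (hP _) (hz' i).symm
  rw [Real.rpow_logb two_pos (by norm_num) (by positivity)]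
  field_simp

theorem prodProb_le_two_rpow_mul {A : Type*} {Q P : A → ℝ} (hQ : ∀ a, 0 ≤ Q a)
    (hP : ∀ a, 0 ≤ P a) (hQP : ∀ a, P a = 0 → Q a = 0) {n : ℕ} (z : Fin n → A) {c : ℝ}
    (hc : ∑ i, Real.logb 2 (Q (z i) / P (z i)) ≤ c) :
    prodProb Q z ≤ (2 : ℝ) ^ c * prodProb P z := by
  by_cases h : ∃ i, Q (z i) = 0
  · obtain ⟨i, hi⟩ := h
    rw [prodProb, Finset.prod_eq_zero (Finset.mem_univ i) hi]
    exact mul_nonneg (by positivity) (prodProb_nonneg hP z)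
  · push Not at h
    rw [prodProb_eq_two_rpow_mul hQ hP z h fun i hi => h i (hQP _ hi)]
    exact mul_le_mul_of_nonneg_right (Real.rpow_le_rpow_of_exponent_le one_le_two hc)
      (prodProb_nonneg hP z)

/-- Change of measure for the excess-distortion probability. -/
theorem excessProb_le_of_relEntropy_lt {X Y Xh Yh : Type*} [Fintype X] [Fintype Y]
    {P Q : X × Y → ℝ} (hP : P ∈ stdSimplex ℝ (X × Y)) (hQ : Q ∈ stdSimplex ℝ (X × Y))
    (dX : X → Xh → ℝ) (dY : Y → Yh → ℝ) (D1 D2 : ℝ) {c : ℝ}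
    (hQP : ∀ a, P a = 0 → Q a = 0) (hc : ∑ a, Q a * Real.logb 2 (Q a / P a) < c) :
    ∃ V : ℝ, ∀ n : ℕ, 0 < n → ∀ (M0 M1 M2 : ℕ) (C : Code X Y Xh Yh n M0 M1 M2),
      excessProb Q dX dY D1 D2 C ≤ V / n + 2 ^ (n * c) * excessProb P dX dY D1 D2 C := by
  obtain ⟨V, hV⟩ := sum_prodProb_lt_le hQ (fun a => Real.logb 2 (Q a / P a)) hc
  refine ⟨V, fun n hn M0 M1 M2 C => ?_⟩
  refine le_trans ?_ (add_le_add_left (hV n hn) _)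
  rw [excessProb_eq, excessProb_eq, Finset.mul_sum, ← Finset.sum_add_distrib]
  refine Finset.sum_le_sum fun z _ => ?_
  have hQz := prodProb_nonneg hQ.1 z
  have hPz : 0 ≤ (2 : ℝ) ^ (n * c) * prodProb P z :=
    mul_nonneg (by positivity) (prodProb_nonneg hP.1 z)
  by_cases hl : n * c < ∑ i, Real.logb 2 (Q (z i) / P (z i))
  · rw [if_pos hl]
    split_ifs <;> linarith
  · have := prodProb_le_two_rpow_mul hQ.1 hP.1 hQP z (not_lt.mp hl)
    rw [if_neg hl]
    split_ifs <;> linarith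

theorem exists_distortion_bound {A B : Type*} [Finite A] [Finite B] (d : A → B → ℝ) :
    ∃ K : ℝ, 0 ≤ K ∧ ∀ a b, d a b ≤ K := by
  obtain ⟨K, hK⟩ := (Set.finite_range fun p : A × B => d p.1 p.2).bddAbove
  exact ⟨max K 0, le_max_right _ _, fun a b => (hK ⟨(a, b), rfl⟩).trans (le_max_left _ _)⟩

theorem limsup_le_of_le_add {u v : ℕ → ℝ} {D K : ℝ} (h : ∀ n, u n ≤ D + K * v n)
    (hv : Tendsto v atTop (𝓝 0)) : limsup (fun n => (u n : EReal)) atTop ≤ (D : EReal) := by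
  have h1 : Tendsto (fun n => ((D + K * v n : ℝ) : EReal)) atTop (𝓝 (D : EReal)) := by
    refine (continuous_coe_real_ereal.tendsto D).comp ?_
    simpa using (hv.const_mul K).const_add D
  rw [← h1.limsup_eq]
  exact limsup_le_limsup (Eventually.of_forall fun n => EReal.coe_le_coe_iff.mpr (h n))

/-- The converse: a source with rates outside its region bounds the achievable exponents. -/
theorem AchievableExponent.le_relEntropy {X Y Xh Yh : Type*} [Fintype X] [Fintype Y] [Fintype Xh]
    [Fintype Yh] {P Q : X × Y → ℝ} (hP : P ∈ stdSimplex ℝ (X × Y))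
    (hQ : Q ∈ stdSimplex ℝ (X × Y)) {dX : X → Xh → ℝ} {dY : Y → Yh → ℝ} {D1 D2 R0 R1 R2 E : ℝ}
    (hD1 : 0 < D1) (hD2 : 0 < D2) (hE : AchievableExponent P dX dY R0 R1 R2 D1 D2 E)
    (hR : (R0, R1, R2) ∉ achievableRates Q dX dY D1 D2) : (E : EReal) ≤ relEntropy Q P := by
  by_contra! hlt
  obtain ⟨hE0, M0, M1, M2, C, h0, h1, h2, hexp⟩ := hE
  unfold relEntropy at hlt
  split_ifs at hlt with hQP
  · rw [EReal.coe_lt_coe_iff] at hlt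
    obtain ⟨c, hDc, hcE⟩ := exists_between hlt
    obtain ⟨c', hcc', hc'E⟩ := exists_between hcE
    obtain ⟨V, hV⟩ := excessProb_le_of_relEntropy_lt hP hQ dX dY D1 D2 hQP hDc
    have hPsmall : ∀ᶠ n : ℕ in atTop, excessProb P dX dY D1 D2 (C n) ≤ 2 ^ (-(n * c')) := by
      have := eventually_lt_of_lt_liminf
        (lt_of_lt_of_le (EReal.coe_lt_coe_iff.mpr hc'E) hexp)
      filter_upwards [this, eventually_gt_atTop 0] with n hn hn0
      have hn' : (0 : ℝ) < n := by exact_mod_cast hn0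
      unfold errExponent at hn
      split_ifs at hn with hz
      · rw [hz]; positivity
      · have hpos : 0 < excessProb P dX dY D1 D2 (C n) :=
          lt_of_le_of_ne (excessProb_nonneg hP.1 _ _ _ _ _) (Ne.symm hz)
        rw [EReal.coe_lt_coe_iff, lt_div_iff₀ hn'] at hn
        rw [← Real.logb_le_iff_le_rpow one_lt_two hpos]
        linarith
    have hlim : Tendsto (fun n : ℕ => V / n + (2 : ℝ) ^ (n * (c - c'))) atTop (𝓝 0) := by
      have t1 := tendsto_const_div_atTop_nhds_zero_nat V
      have t2 : Tendsto (fun n : ℕ => ((2 : ℝ) ^ (c - c')) ^ n) atTop (𝓝 0) :=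
        tendsto_pow_atTop_nhds_zero_of_lt_one (by positivity)
          (Real.rpow_lt_one_of_one_lt_of_neg one_lt_two (by linarith))
      have t3 := t1.add t2
      rw [add_zero] at t3
      refine t3.congr fun n => ?_
      rw [← Real.rpow_natCast, ← Real.rpow_mul zero_le_two, mul_comm (n : ℝ)]
    have hQsmall : Tendsto (fun n => excessProb Q dX dY D1 D2 (C n)) atTop (𝓝 0) := by
      refine tendsto_of_tendsto_of_tendsto_of_le_of_le' tendsto_const_nhds hlim
        (Eventually.of_forall fun n => excessProb_nonneg hQ.1 _ _ _ _ _) ?_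
      filter_upwards [hPsmall, eventually_gt_atTop 0] with n hn hn0
      refine (hV n hn0 _ _ _ (C n)).trans (add_le_add_right ?_ _)
      refine (mul_le_mul_of_nonneg_left hn (by positivity)).trans (le_of_eq ?_)
      rw [← Real.rpow_add two_pos]
      congr 1
      ring
    obtain ⟨K, hK, hdK⟩ := exists_distortion_bound dX
    obtain ⟨L, hL, hdL⟩ := exists_distortion_bound dY
    exact hR ⟨M0, M1, M2, C, h0, h1, h2,
      limsup_le_of_le_add (fun n => expDistX_le hQ dX dY D2 hD1.le hK hdK (C n)) hQsmall,
      limsup_le_of_le_add (fun n => expDistY_le hQ dX dY D1 hD2.le hL hdL (C n)) hQsmall⟩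
  · exact absurd hlt not_top_lt

/-- Repeating a code sufficiently often makes the probability small that one of the two total
distortions exceeds a level above its mean. -/
theorem exists_repeated_cover {X Y Xh Yh : Type*} [Fintype X] [Fintype Y] {Q : X × Y → ℝ}
    (hQ : Q ∈ stdSimplex ℝ (X × Y)) {dX : X → Xh → ℝ} {dY : Y → Yh → ℝ} {k M0 M1 M2 : ℕ}
    (hk : 0 < k) (c : Code X Y Xh Yh k M0 M1 M2) {a1 a2 θ : ℝ} (h1 : expDistX Q dX c < a1)
    (h2 : expDistY Q dY c < a2) (hθ : 0 < θ) :
    ∃ L : ℕ, 0 < L ∧ ∃ G : Set (Fin L × Fin k → X × Y),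
      Covers dX dY (Fin L → Fin M0) (Fin L → Fin M1) (Fin L → Fin M2) (L * k * a1) (L * k * a2) G ∧
      ∀ [DecidablePred (· ∈ G)], ∑ w, (if w ∉ G then prodProb Q w else 0) < θ := by
  classical
  have hk' : (0 : ℝ) < k := by exact_mod_cast hk
  let fX : (Fin k → X × Y) → ℝ := fun w =>
    ∑ i, dX (w i).1 (c.xhat (fun i => (w i).1) (fun i => (w i).2) i)
  let fY : (Fin k → X × Y) → ℝ := fun w =>
    ∑ i, dY (w i).2 (c.yhat (fun i => (w i).1) (fun i => (w i).2) i)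
  have hfX : ∑ w, prodProb Q w * fX w < k * a1 := by
    rw [expDistX_eq] at h1
    refine lt_of_eq_of_lt ?_ (mul_lt_mul_of_pos_left h1 hk')
    rw [Finset.mul_sum]
    refine Finset.sum_congr rfl fun w _ => ?_
    simp only [avgDist, fX]
    field_simp
  have hfY : ∑ w, prodProb Q w * fY w < k * a2 := by
    rw [expDistY_eq] at h2
    refine lt_of_eq_of_lt ?_ (mul_lt_mul_of_pos_left h2 hk')
    rw [Finset.mul_sum]
    refine Finset.sum_congr rfl fun w _ => ?_
    simp only [avgDist, fY]
    field_simp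
  obtain ⟨V, hV⟩ := sum_prodProb_lt_le (prodProb_mem_stdSimplex (ι := Fin k) hQ) fX hfX
  obtain ⟨W, hW⟩ := sum_prodProb_lt_le (prodProb_mem_stdSimplex (ι := Fin k) hQ) fY hfY
  have hlim : Tendsto (fun L : ℕ => V / L + W / L) atTop (𝓝 0) := by
    simpa using (tendsto_const_div_atTop_nhds_zero_nat V).add
      (tendsto_const_div_atTop_nhds_zero_nat W)
  obtain ⟨L, hL, hL0⟩ := ((hlim.eventually_lt_const hθ).and (eventually_gt_atTop 0)).exists
  refine ⟨L, hL0, {z | ∑ j, fX (fun i => z (j, i)) ≤ L * (k * a1) ∧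
    ∑ j, fY (fun i => z (j, i)) ≤ L * (k * a2)}, ?_, ?_⟩
  · refine ⟨fun z j => c.f0 (fun i => (z (j, i)).1) fun i => (z (j, i)).2,
      fun z j => c.f1 (fun i => (z (j, i)).1) fun i => (z (j, i)).2,
      fun z j => c.f2 (fun i => (z (j, i)).1) fun i => (z (j, i)).2,
      fun a b p => c.φ1 (a p.1) (b p.1) p.2, fun a b p => c.φ2 (a p.1) (b p.1) p.2, ?_⟩
    rintro z ⟨hz1, hz2⟩
    rw [Fintype.sum_prod_type, Fintype.sum_prod_type, mul_assoc, mul_assoc]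
    exact ⟨hz1, hz2⟩
  · intro _
    refine lt_of_le_of_lt ?_ hL
    refine le_trans ?_ (add_le_add (hV L hL0) (hW L hL0))
    rw [← Finset.sum_add_distrib, ← (Equiv.curry (Fin L) (Fin k) (X × Y)).sum_comp]
    refine Finset.sum_le_sum fun z _ => ?_
    have hz : prodProb (fun w : Fin k → X × Y => prodProb Q w)
        (Equiv.curry (Fin L) (Fin k) (X × Y) z) = prodProb Q z := by
      simp only [prodProb, Fintype.prod_prod_type]
      rfl
    have hz0 := prodProb_nonneg hQ.1 z
    rw [hz]
    change _ ≤ (if L * (k * a1) < ∑ j, fX (fun i => z (j, i)) then _ else _) +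
      (if L * (k * a2) < ∑ j, fY (fun i => z (j, i)) then _ else _)
    by_cases hm : ∑ j, fX (fun i => z (j, i)) ≤ L * (k * a1)
    · by_cases hm' : ∑ j, fY (fun i => z (j, i)) ≤ L * (k * a2)
      · rw [if_neg (not_not.mpr (by exact ⟨hm, hm'⟩)),
          if_neg (not_lt.mpr hm), if_neg (not_lt.mpr hm'), add_zero]
      · rw [if_pos (not_le.mp hm')]
        split_ifs <;> linarith
    · rw [if_pos (not_le.mp hm)]
      split_ifs <;> linarith

open scoped Nat in
/-- The first-moment bound for random permutations: all sequences for whose empirical distribution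
the blocks outside `G` have probability at most `θ` are covered by few permuted block codes. -/
theorem Covers.permuted {X Y Xh Yh J κ C A0 A1 A2 : Type*} [Fintype X] [Fintype Y] [Fintype J]
    [Fintype κ] [DecidableEq κ] [Fintype C] [Nonempty J] [Nonempty κ] {dX : X → Xh → ℝ}
    {dY : Y → Yh → ℝ} {Δ1 Δ2 B θ : ℝ} {G : Set (κ → X × Y)} [DecidablePred (· ∈ G)]
    [DecidableEq (X × Y)]
    (hdX0 : ∀ x, ∃ xh, dX x xh = 0) (hdY0 : ∀ y, ∃ yh, dY y yh = 0)
    (hB : 0 ≤ B) (hBX : ∀ x xh, dX x xh ≤ B) (hBY : ∀ y yh, dY y yh ≤ B)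
    (hΔ1 : 0 ≤ Δ1) (hΔ2 : 0 ≤ Δ2) (hθ : 0 < θ)
    (h : Covers dX dY A0 A1 A2 Δ1 Δ2 G) {n N : ℕ} (hn : Fintype.card ((J × κ) ⊕ C) = n)
    (hfac : (n - Fintype.card κ)! * n ^ Fintype.card κ ≤ 2 * n !) (hN0 : 0 < N)
    (hN : Fintype.card (X × Y) ^ n < 2 ^ N) :
    Covers dX dY (Fin N × ((J → A0) × (C → Xh) × (C → Yh))) (J → A1) (J → A2)
      (Fintype.card J * Δ1 + 4 * θ * Fintype.card J * (Fintype.card κ * B))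
      (Fintype.card J * Δ2 + 4 * θ * Fintype.card J * (Fintype.card κ * B))
      {z : (J × κ) ⊕ C → X × Y |
        ∑ w : κ → X × Y, (if w ∉ G then prodProb (empirical z) w else 0) ≤ θ} := by
  classical
  have hblk := Covers.blocks (J := J) (C := C) (4 * θ * Fintype.card J) hdX0 hdY0 hB hBX hBY
    hΔ1 hΔ2 h
  set S : Set ((J × κ) ⊕ C → X × Y) := {z |
    ((Finset.univ.filter fun j => (fun i => z (.inl (j, i))) ∉ G).card : ℝ)
      ≤ 4 * θ * Fintype.card J} with hS
  have hJ : (0 : ℝ) < Fintype.card J := by exact_mod_cast Fintype.card_pos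
  have half : ∀ z ∈ Finset.univ.filter fun z : (J × κ) ⊕ C → X × Y =>
      ∑ w : κ → X × Y, (if w ∉ G then prodProb (empirical z) w else 0) ≤ θ,
      2 * (Finset.univ.filter fun π : Equiv.Perm ((J × κ) ⊕ C) => ¬ (z ∘ π ∈ S)).card
        ≤ Fintype.card (Equiv.Perm ((J × κ) ⊕ C)) := by
    intro z hz
    simp only [Finset.mem_filter, Finset.mem_univ, true_and] at hz
    have h1 : ∑ π : Equiv.Perm ((J × κ) ⊕ C),
        ((Finset.univ.filter fun j => (fun i => z (π (.inl (j, i)))) ∉ G).card : ℝ)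
          ≤ Fintype.card J * (2 * n ! * θ) := by
      calc ∑ π : Equiv.Perm ((J × κ) ⊕ C),
            ((Finset.univ.filter fun j => (fun i => z (π (.inl (j, i)))) ∉ G).card : ℝ)
          = ∑ j : J, ((Finset.univ.filter fun π : Equiv.Perm ((J × κ) ⊕ C) =>
              (fun i => z (π (.inl (j, i)))) ∉ G).card : ℝ) := by
            simp only [Finset.card_filter, Nat.cast_sum]
            rw [Finset.sum_comm]
        _ ≤ ∑ _j : J, (2 * n ! * θ) := by
            refine Finset.sum_le_sum fun j _ => ?_
            have hb : Function.Injective fun i : κ => (Sum.inl (j, i) : (J × κ) ⊕ C) := by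
              intro i i' hi
              simpa using hi
            refine (card_perm_block_le hb z G).trans ?_
            rw [hn]
            have hfac' : ((n - Fintype.card κ)! : ℝ) * (n : ℝ) ^ Fintype.card κ ≤ 2 * n ! := by
              exact_mod_cast hfac
            refine mul_le_mul hfac' hz ?_ (by positivity)
            refine Finset.sum_nonneg fun w _ => ?_
            split_ifs
            exacts [le_rfl, prodProb_nonneg (empirical_mem_stdSimplex z).1 w]
        _ = _ := by simp
    have h2 : ((Finset.univ.filter fun π : Equiv.Perm ((J × κ) ⊕ C) => ¬ (z ∘ π ∈ S)).card : ℝ) *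
        (4 * θ * Fintype.card J) ≤ Fintype.card J * (2 * n ! * θ) := by
      refine le_trans ?_ h1
      rw [Finset.card_filter, Nat.cast_sum, Finset.sum_mul]
      refine Finset.sum_le_sum fun π _ => ?_
      split_ifs with hπ
      · simp
      · rw [Nat.cast_one, one_mul]
        exact (not_le.mp hπ).le
    have h3 : (2 * (Finset.univ.filter fun π : Equiv.Perm ((J × κ) ⊕ C) =>
        ¬ (z ∘ π ∈ S)).card : ℝ) ≤ n ! := by
      have : 0 < 2 * θ * Fintype.card J := by positivity
      refine le_of_mul_le_mul_right ?_ this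
      linarith
    rw [Fintype.card_perm, hn]
    exact_mod_cast h3
  obtain ⟨p, hp⟩ := exists_hitting_family
    (fun (π : Equiv.Perm ((J × κ) ⊕ C)) (z : (J × κ) ⊕ C → X × Y) => z ∘ π ∈ S) N _ half
    (by
      refine lt_of_le_of_lt (Finset.card_le_univ _) ?_
      rwa [Fintype.card_fun, hn])
  have : Nonempty (Fin N) := ⟨⟨0, hN0⟩⟩
  refine (Covers.iUnion fun t => hblk.reindex (p t)).mono (fun z hz => ?_) le_rfl le_rfl
  obtain ⟨t, ht⟩ := hp z (by simpa using hz)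
  exact Set.mem_iUnion.mpr ⟨t, ht⟩

open scoped Nat in
theorem eventually_factorial_mul_pow_le (k : ℕ) :
    ∀ᶠ n : ℕ in atTop, (n - k)! * n ^ k ≤ 2 * n ! := by
  have hlim : Tendsto (fun n : ℕ => (2 : ℝ) * (1 - k / n) ^ k) atTop (𝓝 2) := by
    simpa using (((tendsto_const_div_atTop_nhds_zero_nat (k : ℝ)).const_sub 1).pow k).const_mul 2
  filter_upwards [hlim.eventually_const_lt one_lt_two, eventually_ge_atTop (k + 1)] with n hn hkn
  rw [← Nat.factorial_mul_descFactorial (show k ≤ n by omega), mul_left_comm]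
  refine Nat.mul_le_mul_left _ ?_
  have h1 := Nat.pow_sub_le_descFactorial n k
  have hn0 : (0 : ℝ) < n := by exact_mod_cast (show 0 < n by omega)
  have h2 : ((n : ℝ) - k) ^ k ≤ n.descFactorial k := by
    refine le_trans ?_ (Nat.cast_le.mpr h1)
    push_cast
    rw [Nat.cast_sub (by omega)]
    refine pow_le_pow_left₀ ?_ (by push_cast; linarith) k
    rw [sub_nonneg]
    exact_mod_cast (show k ≤ n by omega)
  have h3 : (n : ℝ) ^ k ≤ 2 * ((n : ℝ) - k) ^ k := by
    have : (n : ℝ) - k = n * (1 - k / n) := by field_simp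
    rw [this, mul_pow]
    have := mul_le_mul_of_nonneg_left hn.le (pow_nonneg hn0.le k)
    linarith
  have : (n : ℝ) ^ k ≤ 2 * n.descFactorial k := by linarith
  exact_mod_cast this

theorem isOpen_setOf_sum_prodProb_lt {κ A : Type*} [Fintype κ] [DecidableEq κ] [Fintype A]
    (G : Set (κ → A)) [DecidablePred (· ∈ G)] (θ : ℝ) :
    IsOpen {Q : A → ℝ | ∑ w : κ → A, (if w ∉ G then prodProb Q w else 0) < θ} := by
  refine isOpen_lt (continuous_finsetSum _ fun w _ => ?_) continuous_const
  split_ifs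
  · exact continuous_const
  · unfold prodProb
    fun_prop

theorem eventually_logb_lt_of_rateAtMost {M : ℕ → ℕ} {R ρ : ℝ} (h : RateAtMost M R) (hρ : R < ρ) :
    ∀ᶠ n : ℕ in atTop, Real.logb 2 (M n) < n * ρ := by
  filter_upwards [eventually_lt_of_limsup_lt (lt_of_le_of_lt h (EReal.coe_lt_coe_iff.mpr hρ)),
    eventually_gt_atTop 0] with n hn hn0
  rw [EReal.coe_lt_coe_iff, div_lt_iff₀ (by exact_mod_cast hn0)] at hn
  linarith

/-- A common rate above the minimum is operationally achieved by codes of some positive length. -/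
theorem exists_code_of_minCommonRate_le {X Y Xh Yh : Type*} [Fintype X] [Fintype Y]
    {Q : X × Y → ℝ} {dX : X → Xh → ℝ} {dY : Y → Yh → ℝ} {D1 D2 R0 R1 R2 δ a1 a2 : ℝ}
    (h : minCommonRate Q dX dY R1 R2 D1 D2 ≤ R0) (hδ : 0 < δ) (h1 : D1 < a1) (h2 : D2 < a2) :
    ∃ (k M0 M1 M2 : ℕ) (c : Code X Y Xh Yh k M0 M1 M2), 0 < k ∧
      Real.logb 2 M0 < k * (R0 + δ) ∧ Real.logb 2 M1 < k * (R1 + δ) ∧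
      Real.logb 2 M2 < k * (R2 + δ) ∧ expDistX Q dX c < a1 ∧ expDistY Q dY c < a2 := by
  have hlt : minCommonRate Q dX dY R1 R2 D1 D2 < ((R0 + δ / 2 : ℝ) : EReal) :=
    lt_of_le_of_lt h (EReal.coe_lt_coe_iff.mpr (by linarith))
  simp only [minCommonRate, iInf_lt_iff] at hlt
  obtain ⟨r, hr, hrlt⟩ := hlt
  rw [EReal.coe_lt_coe_iff] at hrlt
  obtain ⟨⟨s0, s1, s2⟩, ⟨M0, M1, M2, c, hM0, hM1, hM2, hX, hY⟩, hdist⟩ :=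
    Metric.mem_closure_iff.mp hr (δ / 2) (by linarith)
  simp only [Prod.dist_eq, max_lt_iff, Real.dist_eq, abs_lt] at hdist
  obtain ⟨n, hn0, e0, e1, e2, eX, eY⟩ := ((eventually_gt_atTop 0).and
    ((eventually_logb_lt_of_rateAtMost hM0 (show s0 < R0 + δ by linarith [hdist.1.1])).and
    ((eventually_logb_lt_of_rateAtMost hM1 (show s1 < R1 + δ by linarith [hdist.2.1.1])).and
    ((eventually_logb_lt_of_rateAtMost hM2 (show s2 < R2 + δ by linarith [hdist.2.2.1])).and
    ((eventually_lt_of_limsup_lt (lt_of_le_of_lt hX (EReal.coe_lt_coe_iff.mpr h1))).and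
    (eventually_lt_of_limsup_lt (lt_of_le_of_lt hY (EReal.coe_lt_coe_iff.mpr h2)))))))).exists
  exact ⟨n, _, _, _, c n, hn0, e0, e1, e2, EReal.coe_lt_coe_iff.mp eX, EReal.coe_lt_coe_iff.mp eY⟩

theorem eventually_mul_add_le_two_rpow (a b : ℝ) {c : ℝ} (hc : 0 < c) :
    ∀ᶠ n : ℕ in atTop, a * n + b ≤ (2 : ℝ) ^ (n * c) := by
  have h1 : (1 : ℝ) < 2 ^ c := Real.one_lt_rpow one_lt_two hc
  have t := ((tendsto_pow_const_div_const_pow_of_one_lt 1 h1).const_mul a).add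
    ((tendsto_pow_const_div_const_pow_of_one_lt 0 h1).const_mul b)
  simp only [mul_zero, add_zero, pow_one, pow_zero] at t
  filter_upwards [t.eventually_lt_const one_pos] with n hn
  have hpos : (0 : ℝ) < (2 ^ c) ^ n := by positivity
  rw [mul_comm (n : ℝ), Real.rpow_mul zero_le_two, Real.rpow_natCast]
  have : a * (n / (2 ^ c) ^ n) + b * (1 / (2 ^ c) ^ n) = (a * n + b) / (2 ^ c) ^ n := by ring
  rw [this, div_lt_one hpos] at hn
  exact hn.le

theorem pow_pow_le_two_rpow {M k L m n : ℕ} {ρ : ℝ} (hM : 0 < M) (hρ : 0 ≤ ρ)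
    (h : Real.logb 2 M < k * ρ) (hn : m * (L * k) ≤ n) :
    (((M ^ L) ^ m : ℕ) : ℝ) ≤ (2 : ℝ) ^ (n * ρ) := by
  have hM' : (0 : ℝ) < M := by exact_mod_cast hM
  have h1 : (M : ℝ) ≤ 2 ^ (k * ρ) := (Real.logb_le_iff_le_rpow one_lt_two hM').mp h.le
  push_cast
  rw [← pow_mul]
  refine (pow_le_pow_left₀ hM'.le h1 _).trans ?_
  rw [← Real.rpow_natCast, ← Real.rpow_mul zero_le_two]
  refine Real.rpow_le_rpow_of_exponent_le one_le_two ?_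
  have hn' : ((m * (L * k) : ℕ) : ℝ) ≤ n := Nat.cast_le.mpr hn
  have := mul_le_mul_of_nonneg_right hn' hρ
  push_cast at this ⊢
  linarith

/-- Around each distribution whose minimum common rate is at most `R0`, all types are covered. -/
theorem exists_isOpen_eventually_covers {X Y Xh Yh : Type*} [Fintype X] [Fintype Y] [Fintype Xh]
    [Fintype Yh] [DecidableEq (X × Y)] {dX : X → Xh → ℝ} {dY : Y → Yh → ℝ}
    (hdX0 : ∀ x, ∃ xh, dX x xh = 0) (hdY0 : ∀ y, ∃ yh, dY y yh = 0) {Q : X × Y → ℝ}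
    (hQ : Q ∈ stdSimplex ℝ (X × Y)) {D1 D2 R0 R1 R2 δ : ℝ} (hD1 : 0 < D1) (hD2 : 0 < D2)
    (hR0 : 0 ≤ R0) (hR1 : 0 ≤ R1) (hR2 : 0 ≤ R2) (hδ : 0 < δ)
    (h : minCommonRate Q dX dY R1 R2 D1 D2 ≤ R0) :
    ∃ U : Set (X × Y → ℝ), IsOpen U ∧ Q ∈ U ∧ ∀ᶠ n : ℕ in atTop,
      Covers dX dY (Fin ⌊(2 : ℝ) ^ (n * (R0 + δ))⌋₊) (Fin ⌊(2 : ℝ) ^ (n * (R1 + δ))⌋₊)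
        (Fin ⌊(2 : ℝ) ^ (n * (R2 + δ))⌋₊) (n * D1) (n * D2)
        {z : Fin n → X × Y | empirical z ∈ U} := by
  classical
  obtain ⟨⟨x₀, y₀⟩⟩ : Nonempty (X × Y) := by
    by_contra hne
    rw [not_nonempty_iff] at hne
    simpa using hQ.2
  have : Nonempty Xh := ⟨(hdX0 x₀).choose⟩
  have : Nonempty Yh := ⟨(hdY0 y₀).choose⟩
  set q : ℕ := Fintype.card Xh * Fintype.card Yh with hq
  have hq0 : (0 : ℝ) < q := by
    exact_mod_cast Nat.mul_pos Fintype.card_pos Fintype.card_pos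
  set η : ℝ := δ / (8 * q) with hη
  have hη0 : 0 < η := by positivity
  obtain ⟨k, M0, M1, M2, c, hk, hM0, hM1, hM2, hcX, hcY⟩ := exists_code_of_minCommonRate_le h
    (half_pos hδ) (show D1 < (1 + η) * D1 by nlinarith) (show D2 < (1 + η) * D2 by nlinarith)
  obtain ⟨B1, hB1, hdX⟩ := exists_distortion_bound dX
  obtain ⟨B2, hB2, hdY⟩ := exists_distortion_bound dY
  set B : ℝ := B1 + B2 + 1 with hB
  have hB0 : 0 < B := by positivity
  have hD : 0 < min D1 D2 := lt_min hD1 hD2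
  set θ : ℝ := η * min D1 D2 / (4 * B) with hθ
  have hθ0 : 0 < θ := by positivity
  have hθB : 4 * θ * B = η * min D1 D2 := by rw [hθ]; field_simp
  obtain ⟨L, hL, G, hG, hGQ⟩ := exists_repeated_cover hQ hk c hcX hcY hθ0
  refine ⟨_, isOpen_setOf_sum_prodProb_lt G θ, hGQ, ?_⟩
  have hLk : (0 : ℝ) < L * k := by exact_mod_cast Nat.mul_pos hL hk
  have hden : 0 < (1 + 2 * η) * (L * k) := by positivity
  have : Nonempty (Fin L) := ⟨⟨0, hL⟩⟩
  have : Nonempty (Fin k) := ⟨⟨0, hk⟩⟩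
  have hM0pos : 0 < M0 := Fin.pos (c.f0 (fun _ => x₀) fun _ => y₀)
  have hM1pos : 0 < M1 := Fin.pos (c.f1 (fun _ => x₀) fun _ => y₀)
  have hM2pos : 0 < M2 := Fin.pos (c.f2 (fun _ => x₀) fun _ => y₀)
  filter_upwards [eventually_factorial_mul_pow_le (L * k),
    eventually_mul_add_le_two_rpow (Fintype.card (X × Y) * 2 ^ (q * (L * k)))
      (2 ^ (q * (L * k))) (show 0 < δ / 4 by positivity),
    (tendsto_natCast_atTop_atTop (R := ℝ)).eventually_ge_atTop ((1 + 2 * η) * (L * k))]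
    with n hfac hsize hlarge
  set m : ℕ := ⌊n / ((1 + 2 * η) * (L * k))⌋₊ with hm
  have hm1 : 0 < m := Nat.floor_pos.mpr ((one_le_div hden).mpr hlarge)
  have hmle : m * ((1 + 2 * η) * (L * k)) ≤ n :=
    (le_div_iff₀ hden).mp (Nat.floor_le (by positivity))
  have hmgt : n < (m + 1) * ((1 + 2 * η) * (L * k)) :=
    (div_lt_iff₀ hden).mp (Nat.lt_floor_add_one _)
  have hmLk : (0 : ℝ) ≤ m * (L * k) := by positivity
  have hmn : m * (L * k) ≤ n := by
    have : ((m * (L * k) : ℕ) : ℝ) ≤ n := by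
      push_cast
      nlinarith
    exact_mod_cast this
  set r : ℕ := n - m * (L * k) with hr
  have hrn : (r : ℝ) ≤ 2 * η * n + L * k := by
    rw [hr, Nat.cast_sub hmn]
    push_cast
    have hn0 : (0 : ℝ) ≤ n := by positivity
    have : (n : ℝ) < (1 + 2 * η) * ((m + 1) * (L * k)) := by linarith
    have h3 : (1 + 2 * η) * ((n : ℝ) - m * (L * k)) ≤ (1 + 2 * η) * (2 * η * n + L * k) := by
      nlinarith [mul_nonneg (mul_nonneg hη0.le hη0.le) hn0]
    exact le_of_mul_le_mul_left h3 (by positivity)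
  have hcard : Fintype.card ((Fin m × (Fin L × Fin k)) ⊕ Fin r) = n := by
    simp only [Fintype.card_sum, Fintype.card_prod, Fintype.card_fin]
    omega
  have hcardκ : Fintype.card (Fin L × Fin k) = L * k := by simp
  have : Nonempty (Fin m) := ⟨⟨0, hm1⟩⟩
  have : Nonempty (Fin M0) := ⟨⟨0, hM0pos⟩⟩
  have : Nonempty (Fin M1) := ⟨⟨0, hM1pos⟩⟩
  have : Nonempty (Fin M2) := ⟨⟨0, hM2pos⟩⟩
  set N : ℕ := Fintype.card (X × Y) * n + 1 with hN
  have : Nonempty (Fin N) := ⟨⟨0, Nat.succ_pos _⟩⟩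
  have hNpow : Fintype.card (X × Y) ^ n < 2 ^ N := by
    refine lt_of_le_of_lt (Nat.pow_le_pow_left Nat.lt_two_pow_self.le n) ?_
    rw [← pow_mul]
    exact Nat.pow_lt_pow_right one_lt_two (Nat.lt_succ_self _)
  have hperm := Covers.permuted (J := Fin m) (N := N) (C := Fin r) (B := B) hdX0 hdY0 hB0.le
    (fun x xh => (hdX x xh).trans (by linarith)) (fun y yh => (hdY y yh).trans (by linarith))
    (by positivity) (by positivity) hθ0 hG hcard (by rwa [hcardκ]) (Nat.succ_pos _) hNpow
  have e : (Fin m × (Fin L × Fin k)) ⊕ Fin r ≃ Fin n :=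
    Fintype.equivOfCardEq (by rw [hcard, Fintype.card_fin])
  have hdist : ∀ D : ℝ, 0 < D → min D1 D2 ≤ D →
      Fintype.card (Fin m) * (L * k * ((1 + η) * D)) +
        4 * θ * Fintype.card (Fin m) * (Fintype.card (Fin L × Fin k) * B) ≤ n * D := by
    intro D hD0 hDle
    rw [hcardκ, Fintype.card_fin]
    push_cast
    calc (m : ℝ) * (L * k * ((1 + η) * D)) + 4 * θ * m * (L * k * B)
        = m * (L * k) * ((1 + η) * D + 4 * θ * B) := by ring
      _ ≤ m * (L * k) * ((1 + η) * D + η * D) := by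
          rw [hθB]
          gcongr
      _ = m * ((1 + 2 * η) * (L * k)) * D := by ring
      _ ≤ n * D := by gcongr
  refine Covers.mono (Covers.of_card_le (hperm.reindex e) ?_ ?_ ?_) ?_
    (hdist D1 hD1 (min_le_left _ _)) (hdist D2 hD2 (min_le_right _ _))
  · refine Nat.le_floor ?_
    have c1 := pow_pow_le_two_rpow hM0pos (by positivity) hM0 hmn
    have c2 : ((q ^ r : ℕ) : ℝ) ≤ 2 ^ (n * (δ / 4)) * 2 ^ (q * (L * k)) := by
      have : ((q ^ r : ℕ) : ℝ) ≤ ((2 ^ q) ^ r : ℕ) :=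
        Nat.cast_le.mpr (Nat.pow_le_pow_left Nat.lt_two_pow_self.le r)
      refine this.trans ?_
      push_cast
      rw [← pow_mul, ← Real.rpow_natCast, ← Real.rpow_natCast, ← Real.rpow_add two_pos]
      refine Real.rpow_le_rpow_of_exponent_le one_le_two ?_
      push_cast
      have h4 := mul_le_mul_of_nonneg_left hrn hq0.le
      have h5 : (q : ℝ) * (2 * η * n + L * k) = n * (δ / 4) + q * (L * k) := by
        rw [hη]
        field_simp
        ring
      linarith
    have c3 : (N : ℝ) * 2 ^ (q * (L * k)) ≤ 2 ^ (n * (δ / 4)) := by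
      refine le_trans (le_of_eq ?_) hsize
      rw [hN]
      push_cast
      ring
    simp only [Fintype.card_prod, Fintype.card_fun, Fintype.card_fin]
    rw [← mul_pow, ← hq, Nat.cast_mul, Nat.cast_mul]
    calc (N : ℝ) * ((((M0 ^ L) ^ m : ℕ) : ℝ) * ((q ^ r : ℕ) : ℝ))
        ≤ N * (2 ^ (n * (R0 + δ / 2)) * (2 ^ (n * (δ / 4)) * 2 ^ (q * (L * k)))) := by gcongr
      _ = (N * 2 ^ (q * (L * k))) * (2 ^ (n * (R0 + δ / 2)) * 2 ^ (n * (δ / 4))) := by ring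
      _ ≤ 2 ^ (n * (δ / 4)) * (2 ^ (n * (R0 + δ / 2)) * 2 ^ (n * (δ / 4))) := by gcongr
      _ = 2 ^ (n * (R0 + δ)) := by
          rw [← Real.rpow_add two_pos, ← Real.rpow_add two_pos]
          congr 1
          ring
  · refine Nat.le_floor ?_
    simp only [Fintype.card_fun, Fintype.card_fin]
    refine (pow_pow_le_two_rpow hM1pos (by positivity) hM1 hmn).trans ?_
    refine Real.rpow_le_rpow_of_exponent_le one_le_two ?_
    gcongr
    linarith
  · refine Nat.le_floor ?_
    simp only [Fintype.card_fun, Fintype.card_fin]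
    refine (pow_pow_le_two_rpow hM2pos (by positivity) hM2 hmn).trans ?_
    refine Real.rpow_le_rpow_of_exponent_le one_le_two ?_
    gcongr
    linarith
  · intro z hz
    change ∑ w, (if w ∉ G then prodProb (empirical (z ∘ e)) w else 0) ≤ θ
    rw [empirical_comp_equiv]
    exact le_of_lt hz

theorem Covers.empty {X Y Xh Yh ι A0 A1 A2 : Type*} [Fintype ι] [Nonempty Xh] [Nonempty Yh]
    [Nonempty A0] [Nonempty A1] [Nonempty A2] (dX : X → Xh → ℝ) (dY : Y → Yh → ℝ) (Δ1 Δ2 : ℝ) :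
    Covers dX dY A0 A1 A2 Δ1 Δ2 (∅ : Set (ι → X × Y)) :=
  ⟨fun _ => Classical.arbitrary _, fun _ => Classical.arbitrary _, fun _ => Classical.arbitrary _,
    fun _ _ _ => Classical.arbitrary _, fun _ _ _ => Classical.arbitrary _, by simp⟩

theorem nonempty_fin_floor_two_rpow {x : ℝ} (hx : 0 ≤ x) : Nonempty (Fin ⌊(2 : ℝ) ^ x⌋₊) :=
  ⟨⟨0, Nat.floor_pos.mpr (Real.one_le_rpow one_le_two hx)⟩⟩

/-- All types in a compact set of distributions with minimum common rate at most `R0` are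
covered. -/
theorem eventually_covers_of_isCompact {X Y Xh Yh : Type*} [Fintype X] [Fintype Y] [Fintype Xh]
    [Fintype Yh] [Nonempty Xh] [Nonempty Yh] [DecidableEq (X × Y)] {dX : X → Xh → ℝ}
    {dY : Y → Yh → ℝ} (hdX0 : ∀ x, ∃ xh, dX x xh = 0) (hdY0 : ∀ y, ∃ yh, dY y yh = 0)
    {S : Set (X × Y → ℝ)} (hS : IsCompact S) (hSs : S ⊆ stdSimplex ℝ (X × Y))
    {D1 D2 R0 R1 R2 δ : ℝ} (hD1 : 0 < D1) (hD2 : 0 < D2)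
    (hR0 : 0 ≤ R0) (hR1 : 0 ≤ R1) (hR2 : 0 ≤ R2) (hδ : 0 < δ)
    (h : ∀ Q ∈ S, minCommonRate Q dX dY R1 R2 D1 D2 ≤ R0) :
    ∀ᶠ n : ℕ in atTop,
      Covers dX dY (Fin ⌊(2 : ℝ) ^ (n * (R0 + δ))⌋₊) (Fin ⌊(2 : ℝ) ^ (n * (R1 + δ))⌋₊)
        (Fin ⌊(2 : ℝ) ^ (n * (R2 + δ))⌋₊) (n * D1) (n * D2)
        {z : Fin n → X × Y | empirical z ∈ S} := by
  classical
  have hloc : ∀ Q : S, ∃ U : Set (X × Y → ℝ), IsOpen U ∧ Q.1 ∈ U ∧ _ := fun Q =>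
    exists_isOpen_eventually_covers hdX0 hdY0 (hSs Q.2) hD1 hD2 hR0 hR1 hR2 (half_pos hδ) (h Q Q.2)
  choose U hU hQU hev using hloc
  obtain ⟨t, ht⟩ := hS.elim_finite_subcover U hU
    fun Q hQ => Set.mem_iUnion.mpr ⟨⟨Q, hQ⟩, hQU ⟨Q, hQ⟩⟩
  have hall : ∀ᶠ n : ℕ in atTop, ∀ Q : t, _ := eventually_all.mpr fun Q : t => hev Q.1
  filter_upwards [hall, eventually_mul_add_le_two_rpow 0 (Fintype.card t) (half_pos hδ)]
    with n hn hsize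
  have ne : ∀ R ε : ℝ, 0 ≤ R → 0 < ε → Nonempty (Fin ⌊(2 : ℝ) ^ (n * (R + ε))⌋₊) :=
    fun R ε hR hε => nonempty_fin_floor_two_rpow (by positivity)
  have := ne R0 (δ / 2) hR0 (half_pos hδ)
  have := ne R1 (δ / 2) hR1 (half_pos hδ)
  have := ne R2 (δ / 2) hR2 (half_pos hδ)
  have := ne R0 δ hR0 hδ
  have := ne R1 δ hR1 hδ
  have := ne R2 δ hR2 hδ
  rcases isEmpty_or_nonempty t with he | he
  · refine (Covers.empty dX dY _ _).mono (fun z hz => ?_) le_rfl le_rfl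
    obtain ⟨Q, hQ, -⟩ := Set.mem_iUnion₂.mp (ht hz)
    exact he.elim ⟨Q, hQ⟩
  · refine Covers.mono (Covers.of_card_le (Covers.iUnion hn) ?_ ?_ ?_) (fun z hz => ?_) le_rfl le_rfl
    · rw [Fintype.card_prod, Fintype.card_fin]
      refine Nat.le_floor ?_
      push_cast
      have h1 := Nat.floor_le (show 0 ≤ (2 : ℝ) ^ (n * (R0 + δ / 2)) by positivity)
      rw [zero_mul, zero_add] at hsize
      refine (mul_le_mul hsize h1 (by positivity) (by positivity)).trans (le_of_eq ?_)
      rw [← Real.rpow_add two_pos]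
      congr 1
      ring
    · rw [Fintype.card_fin]
      refine Nat.floor_le_floor (Real.rpow_le_rpow_of_exponent_le one_le_two ?_)
      gcongr
      linarith
    · rw [Fintype.card_fin]
      refine Nat.floor_le_floor (Real.rpow_le_rpow_of_exponent_le one_le_two ?_)
      gcongr
      linarith
    · obtain ⟨Q, hQ, hz'⟩ := Set.mem_iUnion₂.mp (ht hz)
      exact Set.mem_iUnion.mpr ⟨⟨Q, hQ⟩, hz'⟩

theorem sum_comp_eq_card_mul_sum_empirical {ι A : Type*} [Fintype ι] [Nonempty ι] [Fintype A]
    [DecidableEq A] (z : ι → A) (f : A → ℝ) :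
    ∑ i, f (z i) = Fintype.card ι * ∑ a, empirical z a * f a := by
  rw [← Finset.sum_fiberwise Finset.univ z, Finset.mul_sum]
  refine Finset.sum_congr rfl fun a _ => ?_
  rw [Finset.sum_congr rfl fun i hi => by rw [(Finset.mem_filter.mp hi).2]]
  rw [Finset.sum_const, nsmul_eq_mul]
  unfold empirical
  field_simp

theorem empirical_apply_ne_zero {ι A : Type*} [Fintype ι] [DecidableEq A] (z : ι → A) (i : ι) :
    empirical z (z i) ≠ 0 := by
  have : Nonempty ι := ⟨i⟩
  refine div_ne_zero (Nat.cast_ne_zero.mpr (Finset.card_ne_zero.mpr ⟨i, by simp⟩)) ?_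
  exact Nat.cast_ne_zero.mpr Fintype.card_ne_zero

theorem prodProb_le_of_lt_relEntropy {A : Type*} [Fintype A] [DecidableEq A] {P : A → ℝ}
    (hP : ∀ a, 0 ≤ P a) {n : ℕ} (hn : 0 < n) (z : Fin n → A) {E : ℝ}
    (hE : (E : EReal) < relEntropy (empirical z) P) :
    prodProb P z ≤ 2 ^ (-(n * E)) * prodProb (empirical z) z := by
  have : Nonempty (Fin n) := ⟨⟨0, hn⟩⟩
  have he := (empirical_mem_stdSimplex z).1
  by_cases hz : ∃ i, P (z i) = 0
  · obtain ⟨i, hi⟩ := hz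
    rw [prodProb, Finset.prod_eq_zero (Finset.mem_univ i) hi]
    exact mul_nonneg (by positivity) (prodProb_nonneg he z)
  · push Not at hz
    have hac : ∀ a, P a = 0 → empirical z a = 0 := by
      intro a ha
      unfold empirical
      rw [Finset.filter_eq_empty_iff.mpr fun i _ hi => hz i (by rw [hi]; exact ha)]
      simp
    unfold relEntropy at hE
    rw [if_pos hac, EReal.coe_lt_coe_iff] at hE
    rw [prodProb_eq_two_rpow_mul he hP z (empirical_apply_ne_zero z) hz,
      sum_comp_eq_card_mul_sum_empirical z fun a => Real.logb 2 (empirical z a / P a),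
      ← mul_assoc, ← Real.rpow_add two_pos, Fintype.card_fin]
    have hn' : (0 : ℝ) < n := by exact_mod_cast hn
    have hge : (1 : ℝ) ≤ 2 ^ (-(n * E) + n * ∑ a, empirical z a *
        Real.logb 2 (empirical z a / P a)) := by
      refine Real.one_le_rpow one_le_two ?_
      have := mul_le_mul_of_nonneg_left hE.le hn'.le
      linarith
    exact le_mul_of_one_le_left (prodProb_nonneg hP z) hge

theorem card_image_empirical_le {A : Type*} [Fintype A] [DecidableEq A] (n : ℕ) :
    (Set.range fun z : Fin n → A => empirical z).toFinset.card ≤ (n + 1) ^ Fintype.card A := by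
  classical
  have : (Set.range fun z : Fin n → A => empirical z).toFinset ⊆
      Finset.univ.image fun (t : A → Fin (n + 1)) a => ((t a : ℕ) : ℝ) / n := by
    intro q hq
    obtain ⟨z, rfl⟩ := by simpa using hq
    refine Finset.mem_image.mpr ⟨fun a => ⟨(Finset.univ.filter fun i => z i = a).card, ?_⟩,
      Finset.mem_univ _, ?_⟩
    · have := Finset.card_le_univ (Finset.univ.filter fun i => z i = a)
      rw [Fintype.card_fin] at this
      omega
    · funext a
      simp [empirical]
  refine (Finset.card_le_card this).trans (Finset.card_image_le.trans ?_)
  simp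

/-- The upper bound of Sanov's theorem for the complement of a divergence ball. -/
theorem sum_prodProb_relEntropy_gt_le {A : Type*} [Fintype A] [DecidableEq A] {P : A → ℝ}
    (hP : ∀ a, 0 ≤ P a) {n : ℕ} (hn : 0 < n) (E : ℝ)
    [DecidablePred fun z : Fin n → A => (E : EReal) < relEntropy (empirical z) P] :
    ∑ z : Fin n → A, (if (E : EReal) < relEntropy (empirical z) P then prodProb P z else 0)
      ≤ (n + 1) ^ Fintype.card A * 2 ^ (-(n * E)) := by
  classical
  have : Nonempty (Fin n) := ⟨⟨0, hn⟩⟩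
  calc ∑ z : Fin n → A, (if (E : EReal) < relEntropy (empirical z) P then prodProb P z else 0)
      ≤ ∑ z : Fin n → A, 2 ^ (-(n * E)) * prodProb (empirical z) z := by
        refine Finset.sum_le_sum fun z _ => ?_
        split_ifs with h
        · exact prodProb_le_of_lt_relEntropy hP hn z h
        · exact mul_nonneg (by positivity) (prodProb_nonneg (empirical_mem_stdSimplex z).1 z)
    _ = 2 ^ (-(n * E)) * ∑ q ∈ (Set.range fun z : Fin n → A => empirical z).toFinset,
          ∑ z : Fin n → A with empirical z = q, prodProb (empirical z) z := by
        rw [← Finset.mul_sum]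
        congr 1
        exact (Finset.sum_fiberwise_of_maps_to (fun z _ => by simp) _).symm
    _ ≤ 2 ^ (-(n * E)) * ∑ q ∈ (Set.range fun z : Fin n → A => empirical z).toFinset, 1 := by
        refine mul_le_mul_of_nonneg_left (Finset.sum_le_sum fun q hq => ?_) (by positivity)
        obtain ⟨z₀, rfl⟩ := by simpa using hq
        have hs := empirical_mem_stdSimplex z₀
        rw [← sum_prodProb (ι := Fin n) hs]
        rw [Finset.sum_congr rfl fun z hz => by rw [(Finset.mem_filter.mp hz).2]]
        exact Finset.sum_le_sum_of_subset_of_nonneg (Finset.filter_subset _ _)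
          fun z _ _ => prodProb_nonneg hs.1 z
    _ ≤ _ := by
        rw [mul_comm]
        refine mul_le_mul_of_nonneg_right ?_ (by positivity)
        have := card_image_empirical_le (A := A) n
        simp only [Finset.sum_const, nsmul_eq_mul, mul_one]
        exact_mod_cast this

theorem isCompact_setOf_relEntropy_le {A : Type*} [Fintype A] (P : A → ℝ) (E : ℝ) :
    IsCompact {Q : A → ℝ | Q ∈ stdSimplex ℝ A ∧ relEntropy Q P ≤ (E : EReal)} := by
  have hset : {Q : A → ℝ | Q ∈ stdSimplex ℝ A ∧ relEntropy Q P ≤ (E : EReal)} =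
      stdSimplex ℝ A ∩ ({Q | ∀ a, P a = 0 → Q a = 0} ∩
        {Q | ∑ a, Q a * Real.logb 2 (Q a / P a) ≤ E}) := by
    ext Q
    simp only [Set.mem_ofPred_eq, Set.mem_inter_iff, relEntropy]
    refine and_congr_right fun _ => ?_
    split_ifs with h
    · simp [EReal.coe_le_coe_iff, eq_true h]
    · simp [h]
  rw [hset]
  refine (isCompact_stdSimplex ℝ A).inter_right (IsClosed.inter ?_ ?_)
  · simp only [Set.ofPred_forall]
    exact isClosed_iInter fun a => isClosed_iInter fun _ =>
      isClosed_eq (continuous_apply a) continuous_const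
  · refine isClosed_le (continuous_finsetSum _ fun a _ => ?_) continuous_const
    by_cases ha : P a = 0
    · simpa [ha] using continuous_const
    · have : (fun Q : A → ℝ => Q a * Real.logb 2 (Q a / P a)) = fun Q =>
          P a / Real.log 2 * ((Q a / P a) * Real.log (Q a / P a)) := by
        funext Q
        rw [Real.logb]
        field_simp
      rw [this]
      exact continuous_const.mul
        (Real.continuous_mul_log.comp ((continuous_apply a).div_const _))

theorem Covers.exists_code {X Y Xh Yh : Type*} [Fintype X] [Fintype Y] {dX : X → Xh → ℝ}
    {dY : Y → Yh → ℝ} {n M0 M1 M2 : ℕ} (hn : 0 < n) {D1 D2 : ℝ} {S : Set (Fin n → X × Y)}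
    (h : Covers dX dY (Fin M0) (Fin M1) (Fin M2) (n * D1) (n * D2) S) :
    ∃ c : Code X Y Xh Yh n M0 M1 M2, ∀ z ∈ S,
      avgDist dX (fun i => (z i).1) (c.xhat (fun i => (z i).1) fun i => (z i).2) ≤ D1 ∧
      avgDist dY (fun i => (z i).2) (c.yhat (fun i => (z i).1) fun i => (z i).2) ≤ D2 := by
  obtain ⟨f0, f1, f2, φ1, φ2, h⟩ := h
  refine ⟨⟨fun x y => f0 fun i => (x i, y i), fun x y => f1 fun i => (x i, y i),
    fun x y => f2 fun i => (x i, y i), φ1, φ2⟩, fun z hz => ?_⟩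
  have hn' : (0 : ℝ) < n := by exact_mod_cast hn
  unfold avgDist
  rw [div_le_iff₀' hn', div_le_iff₀' hn']
  exact h z hz

/-- Codes whose rates exceed the given ones by at most `δ`, and whose excess-distortion probability
has the exponent `E` up to a polynomial factor that does not depend on `δ`. -/
theorem eventually_exists_code {X Y Xh Yh : Type*} [Fintype X] [Fintype Y] [Fintype Xh]
    [Fintype Yh] [Nonempty Xh] [Nonempty Yh] {P : X × Y → ℝ} (hP : P ∈ stdSimplex ℝ (X × Y))
    {dX : X → Xh → ℝ} {dY : Y → Yh → ℝ}
    (hdX0 : ∀ x, ∃ xh, dX x xh = 0) (hdY0 : ∀ y, ∃ yh, dY y yh = 0)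
    {D1 D2 R0 R1 R2 δ E : ℝ} (hD1 : 0 < D1) (hD2 : 0 < D2)
    (hR0 : 0 ≤ R0) (hR1 : 0 ≤ R1) (hR2 : 0 ≤ R2) (hδ : 0 < δ)
    (h : ∀ Q ∈ stdSimplex ℝ (X × Y), relEntropy Q P ≤ (E : EReal) →
      minCommonRate Q dX dY R1 R2 D1 D2 ≤ R0) :
    ∀ᶠ n : ℕ in atTop, ∃ (M0 M1 M2 : ℕ) (c : Code X Y Xh Yh n M0 M1 M2),
      Real.logb 2 M0 ≤ n * (R0 + δ) ∧ Real.logb 2 M1 ≤ n * (R1 + δ) ∧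
      Real.logb 2 M2 ≤ n * (R2 + δ) ∧ excessProb P dX dY D1 D2 c ≤
        (n + 1) ^ Fintype.card (X × Y) * 2 ^ (-(n * E)) := by
  classical
  have hcov := eventually_covers_of_isCompact hdX0 hdY0 (isCompact_setOf_relEntropy_le P E)
    (fun Q hQ => hQ.1) hD1 hD2 hR0 hR1 hR2 hδ fun Q hQ => h Q hQ.1 hQ.2
  filter_upwards [hcov, eventually_gt_atTop 0] with n hn hn0
  obtain ⟨c, hc⟩ := hn.exists_code hn0
  have hlog : ∀ R : ℝ, 0 ≤ R → Real.logb 2 (⌊(2 : ℝ) ^ (n * (R + δ))⌋₊ : ℕ) ≤ n * (R + δ) := by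
    intro R hR
    have hpos : 0 < ⌊(2 : ℝ) ^ (n * (R + δ))⌋₊ :=
      Nat.floor_pos.mpr (Real.one_le_rpow one_le_two (by positivity))
    rw [Real.logb_le_iff_le_rpow one_lt_two (by exact_mod_cast hpos)]
    exact Nat.floor_le (by positivity)
  refine ⟨_, _, _, c, hlog R0 hR0, hlog R1 hR1, hlog R2 hR2, ?_⟩
  refine le_trans ?_ (sum_prodProb_relEntropy_gt_le hP.1 hn0 E)
  rw [excessProb_eq]
  refine Finset.sum_le_sum fun z _ => ?_
  have hz := prodProb_nonneg hP.1 z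
  have : Nonempty (Fin n) := ⟨⟨0, hn0⟩⟩
  by_cases hE : (E : EReal) < relEntropy (empirical z) P
  · rw [if_pos hE]
    split_ifs
    exacts [le_rfl, hz]
  · obtain ⟨h1, h2⟩ := hc z ⟨empirical_mem_stdSimplex z, not_lt.mp hE⟩
    rw [if_neg hE, if_neg (not_or.mpr ⟨not_lt.mpr h1, not_lt.mpr h2⟩)]

theorem exists_tendsto_eventually {p : ℕ → ℕ → Prop} (h : ∀ j, ∀ᶠ n in atTop, p j n) :
    ∃ s : ℕ → ℕ, Tendsto s atTop atTop ∧ ∀ᶠ n in atTop, p (s n) n := by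
  classical
  choose N hN using fun j => eventually_atTop.mp (h j)
  refine ⟨fun n => Nat.findGreatest (fun j => N j ≤ n) n, tendsto_atTop.mpr fun j => ?_, ?_⟩
  · filter_upwards [eventually_ge_atTop j, eventually_ge_atTop (N j)] with n h1 h2
    exact Nat.le_findGreatest h1 h2
  · filter_upwards [eventually_ge_atTop (N 0)] with n hn
    exact hN _ n (Nat.findGreatest_spec (P := fun j => N j ≤ n) (Nat.zero_le n) hn)

theorem rateAtMost_of_eventually_le {M : ℕ → ℕ} {R : ℝ} {δ : ℕ → ℝ} (hδ : Tendsto δ atTop (𝓝 0))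
    (h : ∀ᶠ n : ℕ in atTop, Real.logb 2 (M n) ≤ n * (R + δ n)) : RateAtMost M R := by
  have t : Tendsto (fun n => ((R + δ n : ℝ) : EReal)) atTop (𝓝 (R : EReal)) := by
    refine (continuous_coe_real_ereal.tendsto R).comp ?_
    simpa using hδ.const_add R
  unfold RateAtMost
  rw [← t.limsup_eq]
  refine limsup_le_limsup ?_
  filter_upwards [h, eventually_gt_atTop 0] with n hn hn0
  rw [EReal.coe_le_coe_iff, div_le_iff₀' (by exact_mod_cast hn0)]
  exact hn

theorem le_liminf_errExponent {ε : ℕ → ℝ} {E : ℝ} {k : ℕ} (hε : ∀ n, 0 ≤ ε n)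
    (h : ∀ᶠ n : ℕ in atTop, ε n ≤ (n + 1) ^ k * 2 ^ (-(n * E))) :
    (E : EReal) ≤ liminf (fun n => errExponent n (ε n)) atTop := by
  have hlog : Tendsto (fun n : ℕ => Real.log (n + 1) / n) atTop (𝓝 0) := by
    have t := (Real.tendsto_pow_log_div_mul_add_atTop 1 (-1) 1 one_ne_zero).comp
      (tendsto_atTop_add_const_right atTop (1 : ℝ) (tendsto_natCast_atTop_atTop (R := ℝ)))
    refine t.congr fun n => ?_
    simp
  have t : Tendsto (fun n : ℕ => ((E - k / Real.log 2 * (Real.log (n + 1) / n) : ℝ) : EReal)) atTop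
      (𝓝 (E : EReal)) := by
    refine (continuous_coe_real_ereal.tendsto E).comp ?_
    simpa using (hlog.const_mul (k / Real.log 2)).const_sub E
  rw [← t.liminf_eq]
  refine liminf_le_liminf ?_
  filter_upwards [h, eventually_gt_atTop 0] with n hn hn0
  unfold errExponent
  split_ifs with hz
  · exact le_top
  · have hpos : 0 < ε n := lt_of_le_of_ne (hε n) (Ne.symm hz)
    have hn' : (0 : ℝ) < n := by exact_mod_cast hn0
    rw [EReal.coe_le_coe_iff, le_div_iff₀ hn']
    have h1 := Real.logb_le_logb_of_le one_lt_two hpos hn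
    rw [Real.logb_mul (by positivity) (by positivity), Real.logb_rpow two_pos (by norm_num),
      Real.logb_pow] at h1
    have h2 : (E - k / Real.log 2 * (Real.log (n + 1) / n)) * n
        = n * E - k * Real.logb 2 (n + 1) := by
      rw [Real.logb]
      field_simp
    rw [h2]
    linarith

theorem nonempty_code (X Y Xh Yh : Type*) [Nonempty Xh] [Nonempty Yh] (n : ℕ) :
    Nonempty (Code X Y Xh Yh n 1 1 1) :=
  ⟨⟨fun _ _ => 0, fun _ _ => 0, fun _ _ => 0, fun _ _ _ => Classical.arbitrary _,
    fun _ _ _ => Classical.arbitrary _⟩⟩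

theorem achievableExponent_zero {X Y Xh Yh : Type*} [Fintype X] [Fintype Y] [Nonempty Xh]
    [Nonempty Yh] {P : X × Y → ℝ} (hP : P ∈ stdSimplex ℝ (X × Y)) (dX : X → Xh → ℝ)
    (dY : Y → Yh → ℝ) (D1 D2 : ℝ) {R0 R1 R2 : ℝ} (hR0 : 0 ≤ R0) (hR1 : 0 ≤ R1) (hR2 : 0 ≤ R2) :
    AchievableExponent P dX dY R0 R1 R2 D1 D2 0 := by
  have rate : ∀ R : ℝ, 0 ≤ R → RateAtMost (fun _ => 1) R := fun R hR =>
    rateAtMost_of_eventually_le (δ := fun _ => 0) tendsto_const_nhds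
      (Eventually.of_forall fun n => by simpa using by positivity)
  refine ⟨le_rfl, fun _ => 1, fun _ => 1, fun _ => 1, fun n => (nonempty_code X Y Xh Yh n).some,
    rate R0 hR0, rate R1 hR1, rate R2 hR2, le_liminf_errExponent (k := 0)
      (fun n => excessProb_nonneg hP.1 _ _ _ _ _) (Eventually.of_forall fun n => ?_)⟩
  simpa using excessProb_le_one hP _ _ _ _ _

/-- The direct part: `E` is achievable if all sources within divergence `E` have minimum common rate
at most `R0`. -/
theorem achievableExponent_of_forall_minCommonRate_le {X Y Xh Yh : Type*} [Fintype X] [Fintype Y]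
    [Fintype Xh] [Fintype Yh] [Nonempty Xh] [Nonempty Yh] {P : X × Y → ℝ}
    (hP : P ∈ stdSimplex ℝ (X × Y)) {dX : X → Xh → ℝ} {dY : Y → Yh → ℝ}
    (hdX0 : ∀ x, ∃ xh, dX x xh = 0) (hdY0 : ∀ y, ∃ yh, dY y yh = 0)
    {D1 D2 R0 R1 R2 E : ℝ} (hD1 : 0 < D1) (hD2 : 0 < D2)
    (hR0 : 0 ≤ R0) (hR1 : 0 ≤ R1) (hR2 : 0 ≤ R2) (hE : 0 ≤ E)
    (h : ∀ Q ∈ stdSimplex ℝ (X × Y), relEntropy Q P ≤ (E : EReal) →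
      minCommonRate Q dX dY R1 R2 D1 D2 ≤ R0) :
    AchievableExponent P dX dY R0 R1 R2 D1 D2 E := by
  obtain ⟨s, hs, hps⟩ := exists_tendsto_eventually fun j : ℕ =>
    eventually_exists_code hP hdX0 hdY0 hD1 hD2 hR0 hR1 hR2 (Nat.one_div_pos_of_nat (n := j)) h
  have hall : ∀ n, ∃ (M0 M1 M2 : ℕ) (c : Code X Y Xh Yh n M0 M1 M2),
      (∃ (M0 M1 M2 : ℕ) (c : Code X Y Xh Yh n M0 M1 M2),
        Real.logb 2 M0 ≤ n * (R0 + 1 / (s n + 1)) ∧ Real.logb 2 M1 ≤ n * (R1 + 1 / (s n + 1)) ∧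
        Real.logb 2 M2 ≤ n * (R2 + 1 / (s n + 1)) ∧ excessProb P dX dY D1 D2 c ≤
          (n + 1) ^ Fintype.card (X × Y) * 2 ^ (-(n * E))) →
      Real.logb 2 M0 ≤ n * (R0 + 1 / (s n + 1)) ∧ Real.logb 2 M1 ≤ n * (R1 + 1 / (s n + 1)) ∧
        Real.logb 2 M2 ≤ n * (R2 + 1 / (s n + 1)) ∧ excessProb P dX dY D1 D2 c ≤
          (n + 1) ^ Fintype.card (X × Y) * 2 ^ (-(n * E)) := by
    intro n
    by_cases hex : ∃ (M0 M1 M2 : ℕ) (c : Code X Y Xh Yh n M0 M1 M2),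
        Real.logb 2 M0 ≤ n * (R0 + 1 / (s n + 1)) ∧ Real.logb 2 M1 ≤ n * (R1 + 1 / (s n + 1)) ∧
        Real.logb 2 M2 ≤ n * (R2 + 1 / (s n + 1)) ∧ excessProb P dX dY D1 D2 c ≤
          (n + 1) ^ Fintype.card (X × Y) * 2 ^ (-(n * E))
    · obtain ⟨M0, M1, M2, c, hc⟩ := hex
      exact ⟨M0, M1, M2, c, fun _ => hc⟩
    · exact ⟨1, 1, 1, (nonempty_code X Y Xh Yh n).some, fun hex' => absurd hex' hex⟩
  choose M0 M1 M2 c hc using hall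
  have hδ : Tendsto (fun n => (1 : ℝ) / (s n + 1)) atTop (𝓝 0) :=
    tendsto_one_div_add_atTop_nhds_zero_nat.comp hs
  exact ⟨hE, M0, M1, M2, c, rateAtMost_of_eventually_le hδ (hps.mono fun n hn => (hc n hn).1),
    rateAtMost_of_eventually_le hδ (hps.mono fun n hn => (hc n hn).2.1),
    rateAtMost_of_eventually_le hδ (hps.mono fun n hn => (hc n hn).2.2.1),
    le_liminf_errExponent (fun n => excessProb_nonneg hP.1 _ _ _ _ _)
      (hps.mono fun n hn => (hc n hn).2.2.2)⟩

theorem expFun_mono {X Y Xh Yh : Type*} [Fintype X] [Fintype Y] (P : X × Y → ℝ)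
    (dX : X → Xh → ℝ) (dY : Y → Yh → ℝ) (R1 R2 D1 D2 : ℝ) :
    Monotone fun r => expFun P dX dY r R1 R2 D1 D2 := fun _ _ hr =>
  biInf_mono fun _ hQ => ⟨hQ.1, (EReal.coe_le_coe_iff.mpr hr).trans hQ.2⟩

/-- The reliability function is the right limit of `expFun`. -/
theorem optExponent_eq_sInf {X Y Xh Yh : Type*} [Fintype X] [Fintype Y]
    [Fintype Xh] [Fintype Yh] {P : X × Y → ℝ}
    (hP : P ∈ stdSimplex ℝ (X × Y)) {dX : X → Xh → ℝ} {dY : Y → Yh → ℝ}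
    (hdX0 : ∀ x, ∃ xh, dX x xh = 0) (hdY0 : ∀ y, ∃ yh, dY y yh = 0)
    {D1 D2 R0 R1 R2 : ℝ} (hD1 : 0 < D1) (hD2 : 0 < D2)
    (hR0 : 0 ≤ R0) (hR1 : 0 ≤ R1) (hR2 : 0 ≤ R2) :
    optExponent P dX dY R0 R1 R2 D1 D2
      = sInf ((fun r => expFun P dX dY r R1 R2 D1 D2) '' Set.Ioi R0) := by
  obtain ⟨⟨x₀, y₀⟩⟩ : Nonempty (X × Y) := by
    by_contra hne
    rw [not_nonempty_iff] at hne
    simpa using hP.2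
  have : Nonempty Xh := ⟨(hdX0 x₀).choose⟩
  have : Nonempty Yh := ⟨(hdY0 y₀).choose⟩
  apply le_antisymm
  · refine iSup₂_le fun E hE => le_sInf ?_
    rintro _ ⟨r, hr, rfl⟩
    refine le_iInf₂ fun Q hQ => hE.le_relEntropy hP hQ.1 hD1 hD2 fun hmem => ?_
    have h1 : minCommonRate Q dX dY R1 R2 D1 D2 ≤ R0 :=
      iInf₂_le (f := fun (r : ℝ) (_ : r ∈ {r : ℝ | (r, R1, R2) ∈ rateRegion Q dX dY D1 D2}) =>
        (r : EReal)) R0 (subset_closure hmem)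
    exact absurd (EReal.coe_le_coe_iff.mp (hQ.2.trans h1)) (not_le.mpr hr)
  · refine EReal.ge_of_forall_gt_iff_ge.mp fun E hE => ?_
    rcases lt_or_ge E 0 with hneg | hE0
    · exact (EReal.coe_le_coe_iff.mpr hneg.le).trans
        (le_iSup₂_of_le 0 (achievableExponent_zero hP dX dY D1 D2 hR0 hR1 hR2) le_rfl)
    · refine le_iSup₂_of_le E ?_ le_rfl
      refine achievableExponent_of_forall_minCommonRate_le hP hdX0 hdY0 hD1 hD2 hR0 hR1 hR2 hE0
        fun Q hQ hQE => ?_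
      by_contra! hlt
      obtain ⟨r, hr0, hr⟩ := EReal.lt_iff_exists_real_btwn.mp hlt
      have h1 : sInf ((fun r => expFun P dX dY r R1 R2 D1 D2) '' Set.Ioi R0)
          ≤ expFun P dX dY r R1 R2 D1 D2 := sInf_le ⟨r, EReal.coe_lt_coe_iff.mp hr0, rfl⟩
      have h2 : expFun P dX dY r R1 R2 D1 D2 ≤ relEntropy Q P := iInf₂_le Q ⟨hQ, hr.le⟩
      exact absurd (h1.trans (h2.trans hQE)) (not_le.mpr hE)

end GrayWyner

theorem theorem2 {X Y Xh Yh : Type*} [Fintype X] [Fintype Y] [Fintype Xh] [Fintype Yh]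
    (P : X × Y → ℝ) (hP : P ∈ stdSimplex ℝ (X × Y))
    (dX : X → Xh → ℝ) (dY : Y → Yh → ℝ)
    (hdX : ∀ x xh, 0 ≤ dX x xh) (hdY : ∀ y yh, 0 ≤ dY y yh)
    (hdX0 : ∀ x, ∃ xh, dX x xh = 0) (hdY0 : ∀ y, ∃ yh, dY y yh = 0)
    (D1 D2 : ℝ) (hD1 : 0 < D1) (hD2 : 0 < D2)
    (R1 R2 : ℝ) (hR1 : 0 ≤ R1) (hR2 : 0 ≤ R2) :
    (∀ R0 : ℝ, 0 ≤ R0 →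
      (GrayWyner.optExponent P dX dY R0 R1 R2 D1 D2
          = GrayWyner.expFun P dX dY R0 R1 R2 D1 D2 ↔
        ContinuousWithinAt (fun r => GrayWyner.expFun P dX dY r R1 R2 D1 D2) (Set.Ici R0) R0)) ∧
    {R0 : ℝ | 0 ≤ R0 ∧ GrayWyner.optExponent P dX dY R0 R1 R2 D1 D2
        ≠ GrayWyner.expFun P dX dY R0 R1 R2 D1 D2}.Countable ∧
    (∀ R0 : ℝ, 0 ≤ R0 →
      Tendsto (fun r => GrayWyner.expFun P dX dY r R1 R2 D1 D2) (𝓝[>] R0)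
        (𝓝 (GrayWyner.optExponent P dX dY R0 R1 R2 D1 D2))) := by
  have mono := GrayWyner.expFun_mono P dX dY R1 R2 D1 D2
  have lim : ∀ R0 : ℝ, 0 ≤ R0 →
      Tendsto (fun r => GrayWyner.expFun P dX dY r R1 R2 D1 D2) (𝓝[>] R0)
        (𝓝 (GrayWyner.optExponent P dX dY R0 R1 R2 D1 D2)) := by
    intro R0 hR0
    rw [GrayWyner.optExponent_eq_sInf hP hdX0 hdY0 hD1 hD2 hR0 hR1 hR2]
    exact mono.tendsto_nhdsGT R0
  have iff : ∀ R0 : ℝ, 0 ≤ R0 →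
      (GrayWyner.optExponent P dX dY R0 R1 R2 D1 D2
          = GrayWyner.expFun P dX dY R0 R1 R2 D1 D2 ↔
        ContinuousWithinAt (fun r => GrayWyner.expFun P dX dY r R1 R2 D1 D2)
          (Set.Ioi R0) R0) := by
    intro R0 hR0
    constructor
    · intro h
      have := lim R0 hR0
      rwa [h] at this
    · exact fun h => tendsto_nhds_unique (lim R0 hR0) h
  refine ⟨fun R0 hR0 => (iff R0 hR0).trans continuousWithinAt_Ioi_iff_Ici, ?_, lim⟩
  refine (Monotone.countable_not_continuousAt mono).mono fun R0 hR => ?_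
  exact fun h => hR.2 ((iff R0 hR.1).mpr h.continuousWithinAt)
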